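/- **Theorem 7.4 (primal–dual Douglas–Rachford algorithm, quadratic case).** Let $\mathcal X,\mathcal U$ be real Hilbert spaces, let $f:\mathcal X\to\mathbb R\cup\{+\infty\}$ and $g:\mathcal U\to\mathbb R\cup\{+\infty\}$ be convex, proper and lower semicontinuous, let $L:\mathcal X\to\mathcal U$ be a bounded linear operator, let $Q$ be a self-adjoint, positive, nonzero, bounded linear operator on $\mathcal X$, let $c\in\mathcal X$, and set $h(x)=\frac12\langle x,Qx\rangle+\langle x,c\rangle$ and $\beta=\|Q\|$. Consider the primal and dual problems $$\min_{x\in\mathcal X}\; f(x)+g(Lx)+h(x)\quad\text{(P)},\qquad \min_{u\in\mathcal U}\; (f+h)^*(-L^*u)+g^*(u)\quad\text{(D)},$$ where $^*$ on a function denotes the convex conjugate, and assume that there is $x\in\mathcal X$ with $0\in\partial f(x)+L^*\partial g(Lx)+Qx+c$. Let $\tau\in(0,2/\beta)$ and $\sigma>0$ be such that $\sigma\tau\|L\|^2<1$, and let $(\rho^{(i)})_{i\in\mathbb N}$ be a sequence in $[0,2]$ with $\sum_{i}\rho^{(i)}(2-\rho^{(i)})=+\infty$. Let $s^{(0)}\in\mathcal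 X$ and $u^{(0)}\in\mathcal U$, let $\mathrm{prox}_\varphi(x)=\operatorname{argmin}_{x'}\{\varphi(x')+\frac12\|x-x'\|^2\}$, and define sequences, for $i=0,1,\dots$, by either one of the following iterations. Form I: $$\begin{aligned} x^{(i+\frac12)}&=\mathrm{prox}_{\tau f}\big(s^{(i)}-\tfrac\tau2Qs^{(i)}-\tau c\big)\\ u^{(i+\frac12)}&=\mathrm{prox}_{\sigma g^*}\big(u^{(i)}+\sigma L(2x^{(i+\frac12)}-s^{(i)}-\tfrac\tau2Q(2x^{(i+\frac12)}-s^{(i)})-\tau L^*u^{(i)})\big)\\ s^{(i+\frac12)}&=x^{(i+\frac12)}-\tfrac\tau2Q(2x^{(i+\frac12)}-s^{(i)})-\tau L^*u^{(i+\frac12)}\\ s^{(i+1)}&=s^{(i)}+\rho^{(i)}(s^{(i+\frac12)}-s^{(i)})\\ u^{(i+1)}&=u^{(i)}+\rho^{(i)}(u^{(i+\frac12)}-u^{(i)}). \end{aligned}$$ Form II: $$\begin{aligned} u^{(i+\frac12)}&=\mathrm{prox}_{\sigma g^*}\big(u^{(i)}+\sigma L(s^{(i)}-\tfrac\tau2Qs^{(i)}-\tau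 L^*u^{(i)})\big)\\ y^{(i+\frac12)}&=s^{(i)}-\tfrac\tau2Qs^{(i)}-\tau L^*u^{(i+\frac12)}\\ x^{(i+\frac12)}&=\mathrm{prox}_{\tau f}\big(2y^{(i+\frac12)}-s^{(i)}-\tfrac\tau2Q(2y^{(i+\frac12)}-s^{(i)})-\tau c\big)\\ s^{(i+1)}&=s^{(i)}+\rho^{(i)}(x^{(i+\frac12)}-y^{(i+\frac12)})\\ u^{(i+1)}&=u^{(i)}+\rho^{(i)}(u^{(i+\frac12)}-u^{(i)}). \end{aligned}$$ Then, for either iteration, $(x^{(i+\frac12)})_i$ converges weakly to a solution of (P) and $(u^{(i)})_i$ converges weakly to a solution of (D). Moreover, the operator $P=\mathrm{diag}\big(\frac1\tau\mathrm{Id}-\frac12Q,\ \frac1\sigma\mathrm{Id}-\tau LL^*\big)$ on $\mathcal Z=\mathcal X\times\mathcal U$ is bounded, self-adjoint and strongly positive ($P-a\,\mathrm{Id}$ is positive for some real $a>0$); let $\mathcal Z_P$ be $\mathcal Z$ with the inner product $\langle z,Pz'\rangle$. The set-valued operators $$M(x,u)=P^{-1}\big(\partial f(x)+\tfrac12Qx+c,\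 0\big),\qquad N(x,u)=P^{-1}\big(\tfrac12Qx+L^*u,\ -Lx+(\partial g)^{-1}u\big)$$ are maximally monotone in $\mathcal Z_P$. With $J_A=(A+\mathrm{Id})^{-1}$ denoting the resolvent, call Douglas–Rachford iteration for a pair $(A,B)$ of set-valued operators on $\mathcal Z$ the iteration $z^{(i+\frac12)}=J_A(r^{(i)})$, $w^{(i+\frac12)}=J_B(2z^{(i+\frac12)}-r^{(i)})$, $r^{(i+1)}=r^{(i)}+\rho^{(i)}(w^{(i+\frac12)}-z^{(i+\frac12)})$. Then Form I is this iteration for $(M,N)$, with $r^{(i)}=(s^{(i)},u^{(i)})$, $z^{(i+\frac12)}=(x^{(i+\frac12)},u^{(i)})$ and $w^{(i+\frac12)}=(x^{(i+\frac12)}+s^{(i+\frac12)}-s^{(i)},\,u^{(i+\frac12)})$; Form II is this iteration for $(N,M)$, with $r^{(i)}=(s^{(i)},u^{(i)})$, $z^{(i+\frac12)}=(y^{(i+\frac12)},u^{(i+\frac12)})$ and $w^{(i+\frac12)}=(x^{(i+\frac12)},\,2u^{(i+\frac12)}-u^{(i)})$. -/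

import Mathlib

open Filter Topology Set
open scoped Pointwise

noncomputable section

namespace PDDR

/-! ### Convex analysis for extended-real-valued functions on a real Hilbert space -/

/-- `f ∈ Γ₀(H)`: convex (its epigraph is convex), proper (never `-∞`, not identically `+∞`) and
lower semicontinuous. -/
structure Gamma0 {H : Type*} [NormedAddCommGroup H] [InnerProductSpace ℝ H]
    (f : H → EReal) : Prop where
  convex_epigraph : Convex ℝ {p : H × ℝ | f p.1 ≤ (p.2 : EReal)}
  ne_bot : ∀ x, f x ≠ ⊥
  exists_ne_top : ∃ x, f x ≠ ⊤
  lsc : LowerSemicontinuous f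

/-- The subdifferential `∂f`. -/
def subdiff {H : Type*} [NormedAddCommGroup H] [InnerProductSpace ℝ H]
    (f : H → EReal) (x : H) : Set H :=
  {u | ∀ y, f x + ((inner ℝ (y - x) u : ℝ) : EReal) ≤ f y}

/-- The inverse of a set-valued operator. -/
def opInv {H : Type*} (A : H → Set H) (u : H) : Set H := {x | u ∈ A x}

/-- The conjugate `f*(u) = sup_x (⟪u, x⟫ - f x)`. -/
def conj {H : Type*} [NormedAddCommGroup H] [InnerProductSpace ℝ H]
    (f : H → EReal) (u : H) : EReal :=
  ⨆ x, ((inner ℝ u x : ℝ) : EReal) - f x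

/-- The positive multiple `γ f` of an extended-real-valued function. -/
def scale {H : Type*} (γ : ℝ) (f : H → EReal) (x : H) : EReal := (γ : EReal) * f x

/-- The proximity operator `prox_f x = argmin_p { f p + ½ ‖x - p‖² }` (for `f ∈ Γ₀(H)` there is
exactly one minimizer; the value is arbitrary if there is none). -/
def prox {H : Type*} [NormedAddCommGroup H] [InnerProductSpace ℝ H]
    (f : H → EReal) (x : H) : H :=
  Classical.epsilon fun p => IsMinOn (fun y => f y + ((1 / 2 * ‖x - y‖ ^ 2 : ℝ) : EReal)) univ p

/-- Weak convergence of a sequence in a real Hilbert space. -/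
def WeakTendsto {H : Type*} [NormedAddCommGroup H] [InnerProductSpace ℝ H]
    (x : ℕ → H) (l : H) : Prop :=
  Tendsto (fun i => toWeakSpace ℝ H (x i)) atTop (𝓝 (toWeakSpace ℝ H l))

/-- The quadratic function `h(x) = ½ ⟪x, Q x⟫ + ⟪x, c⟫`. -/
def quad {X : Type*} [NormedAddCommGroup X] [InnerProductSpace ℝ X]
    (Q : X →L[ℝ] X) (c : X) (x : X) : EReal :=
  ((1 / 2 * inner ℝ x (Q x) + inner ℝ x c : ℝ) : EReal)

/-! ### The optimization problems -/

/-- `x` minimizes `f + g ∘ L + h`. -/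
def IsPrimalSol {X U : Type*} [NormedAddCommGroup X] [InnerProductSpace ℝ X]
    [NormedAddCommGroup U] [InnerProductSpace ℝ U]
    (f : X → EReal) (g : U → EReal) (L : X →L[ℝ] U) (h : X → EReal) (x : X) : Prop :=
  IsMinOn (fun x => f x + g (L x) + h x) univ x

/-- `u` minimizes `(f + h)*(-L* u) + g*(u)`. -/
def IsDualSol {X U : Type*} [NormedAddCommGroup X] [InnerProductSpace ℝ X] [CompleteSpace X]
    [NormedAddCommGroup U] [InnerProductSpace ℝ U] [CompleteSpace U]
    (f : X → EReal) (g : U → EReal) (L : X →L[ℝ] U) (h : X → EReal) (u : U) : Prop :=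
  IsMinOn (fun u => conj (fun x => f x + h x) (-(ContinuousLinearMap.adjoint L u)) + conj g u)
    univ u

/-! ### The two forms of the iteration -/

/-- Form I; `xh i`, `uh i`, `sh i` stand for the iterates with index `i + 1/2`. -/
structure IsFormI {X U : Type*} [NormedAddCommGroup X] [InnerProductSpace ℝ X] [CompleteSpace X]
    [NormedAddCommGroup U] [InnerProductSpace ℝ U] [CompleteSpace U]
    (f : X → EReal) (g : U → EReal) (L : X →L[ℝ] U) (Q : X →L[ℝ] X) (c : X) (τ σ : ℝ)
    (ρ : ℕ → ℝ) (s₀ : X) (u₀ : U)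
    (xh : ℕ → X) (uh : ℕ → U) (sh s : ℕ → X) (u : ℕ → U) : Prop where
  s_zero : s 0 = s₀
  u_zero : u 0 = u₀
  xh_eq : ∀ i, xh i = prox (scale τ f) (s i - (τ / 2) • Q (s i) - τ • c)
  uh_eq : ∀ i, uh i = prox (scale σ (conj g))
    (u i + σ • L ((2 : ℝ) • xh i - s i - (τ / 2) • Q ((2 : ℝ) • xh i - s i)
      - τ • ContinuousLinearMap.adjoint L (u i)))
  sh_eq : ∀ i, sh i = xh i - (τ / 2) • Q ((2 : ℝ) • xh i - s i)
    - τ • ContinuousLinearMap.adjoint L (uh i)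
  s_succ : ∀ i, s (i + 1) = s i + ρ i • (sh i - s i)
  u_succ : ∀ i, u (i + 1) = u i + ρ i • (uh i - u i)

/-- Form II; `uh i`, `yh i`, `xh i` stand for the iterates with index `i + 1/2`. -/
structure IsFormII {X U : Type*} [NormedAddCommGroup X] [InnerProductSpace ℝ X] [CompleteSpace X]
    [NormedAddCommGroup U] [InnerProductSpace ℝ U] [CompleteSpace U]
    (f : X → EReal) (g : U → EReal) (L : X →L[ℝ] U) (Q : X →L[ℝ] X) (c : X) (τ σ : ℝ)
    (ρ : ℕ → ℝ) (s₀ : X) (u₀ : U)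
    (uh : ℕ → U) (yh xh s : ℕ → X) (u : ℕ → U) : Prop where
  s_zero : s 0 = s₀
  u_zero : u 0 = u₀
  uh_eq : ∀ i, uh i = prox (scale σ (conj g))
    (u i + σ • L (s i - (τ / 2) • Q (s i) - τ • ContinuousLinearMap.adjoint L (u i)))
  yh_eq : ∀ i, yh i = s i - (τ / 2) • Q (s i) - τ • ContinuousLinearMap.adjoint L (uh i)
  xh_eq : ∀ i, xh i = prox (scale τ f)
    ((2 : ℝ) • yh i - s i - (τ / 2) • Q ((2 : ℝ) • yh i - s i) - τ • c)
  s_succ : ∀ i, s (i + 1) = s i + ρ i • (xh i - yh i)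
  u_succ : ∀ i, u (i + 1) = u i + ρ i • (uh i - u i)

/-! ### Monotone operators and the Douglas–Rachford iteration -/

/-- Strongly positive bounded operator: `P - a Id` is positive for some `a > 0`. -/
def StronglyPositive {Z : Type*} [NormedAddCommGroup Z] [InnerProductSpace ℝ Z]
    (P : Z →L[ℝ] Z) : Prop :=
  ∃ a : ℝ, 0 < a ∧ (P - a • ContinuousLinearMap.id ℝ Z).IsPositive

/-- Monotonicity with respect to the inner product `⟪z, z'⟫_P = ⟪z, P z'⟫`. -/
def MonotoneIn {Z : Type*} [NormedAddCommGroup Z] [InnerProductSpace ℝ Z]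
    (P : Z →L[ℝ] Z) (A : Z → Set Z) : Prop :=
  ∀ z z', ∀ v ∈ A z, ∀ v' ∈ A z', 0 ≤ inner ℝ (z - z') (P (v - v'))

/-- Maximal monotonicity with respect to `⟪·, ·⟫_P`. -/
def MaxMonotoneIn {Z : Type*} [NormedAddCommGroup Z] [InnerProductSpace ℝ Z]
    (P : Z →L[ℝ] Z) (A : Z → Set Z) : Prop :=
  MonotoneIn P A ∧ ∀ B : Z → Set Z, MonotoneIn P B → (∀ z, A z ⊆ B z) → B = A

/-- The resolvent `J_A = (A + Id)⁻¹`, as a set-valued operator. -/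
def resolvent {Z : Type*} [NormedAddCommGroup Z] (A : Z → Set Z) : Z → Set Z :=
  opInv fun z => A z + {z}

/-- The relaxed Douglas–Rachford iteration for `0 ∈ A z + B z` with unit stepsize:
`z = J_A s`, `w = J_B (2 z - s)`, `s⁺ = s + ρ (w - z)`, the resolvents being single-valued at the
points where they are evaluated. -/
structure IsDouglasRachford {Z : Type*} [NormedAddCommGroup Z] [InnerProductSpace ℝ Z]
    (A B : Z → Set Z) (ρ : ℕ → ℝ) (s z w : ℕ → Z) : Prop where
  z_eq : ∀ i, resolvent A (s i) = {z i}
  w_eq : ∀ i, resolvent B ((2 : ℝ) • z i - s i) = {w i}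
  s_succ : ∀ i, s (i + 1) = s i + ρ i • (w i - z i)

/-- The preconditioner `P = diag((1/τ) Id - ½ Q, (1/σ) Id - τ L L*)` on the Hilbert product
`X × U`. -/
def precond {X U : Type*} [NormedAddCommGroup X] [InnerProductSpace ℝ X] [CompleteSpace X]
    [NormedAddCommGroup U] [InnerProductSpace ℝ U] [CompleteSpace U]
    (L : X →L[ℝ] U) (Q : X →L[ℝ] X) (τ σ : ℝ) : WithLp 2 (X × U) →L[ℝ] WithLp 2 (X × U) :=
  ((WithLp.prodContinuousLinearEquiv 2 ℝ X U).symm : X × U →L[ℝ] WithLp 2 (X × U)) ∘L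
    (((1 / τ) • ContinuousLinearMap.id ℝ X - (1 / 2 : ℝ) • Q).prodMap
      ((1 / σ) • ContinuousLinearMap.id ℝ U - τ • (L ∘L ContinuousLinearMap.adjoint L))) ∘L
    (WithLp.prodContinuousLinearEquiv 2 ℝ X U : WithLp 2 (X × U) →L[ℝ] X × U)

/-- `M (x, u) = P⁻¹ (∂f(x) + ½ Q x + c, 0)`; `P⁻¹` is written as a preimage under `P`. -/
def opM {X U : Type*} [NormedAddCommGroup X] [InnerProductSpace ℝ X] [CompleteSpace X]
    [NormedAddCommGroup U] [InnerProductSpace ℝ U] [CompleteSpace U]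
    (f : X → EReal) (L : X →L[ℝ] U) (Q : X →L[ℝ] X) (c : X) (τ σ : ℝ)
    (z : WithLp 2 (X × U)) : Set (WithLp 2 (X × U)) :=
  precond L Q τ σ ⁻¹'
    {v | v.fst ∈ subdiff f z.fst + {(1 / 2 : ℝ) • Q z.fst + c} ∧ v.snd = 0}

/-- `N (x, u) = P⁻¹ (½ Q x + L* u, -L x + (∂g)⁻¹ u)`; `P⁻¹` is written as a preimage under
`P`. -/
def opN {X U : Type*} [NormedAddCommGroup X] [InnerProductSpace ℝ X] [CompleteSpace X]
    [NormedAddCommGroup U] [InnerProductSpace ℝ U] [CompleteSpace U]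
    (g : U → EReal) (L : X →L[ℝ] U) (Q : X →L[ℝ] X) (τ σ : ℝ)
    (z : WithLp 2 (X × U)) : Set (WithLp 2 (X × U)) :=
  precond L Q τ σ ⁻¹'
    {v | v.fst = (1 / 2 : ℝ) • Q z.fst + ContinuousLinearMap.adjoint L z.snd ∧
      v.snd ∈ {-(L z.fst)} + opInv (subdiff g) z.snd}

end PDDR

end

/-! Both forms are one splitting method, Douglas–Rachford for `0 ∈ M z + N z`, in the metric of `P`.
A zero of `M + N` is a primal–dual pair: the `P⁻¹` factors out, the two halves of `Q` add up to the
gradient of `h`, and what remains is the optimality system for `x` and `u`. The metric is what makes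
the resolvents explicit. The block `-½ Q` of `P` cancels the `½ Q x` inside `M` and `N`, and the
block `-τ L L*` decouples the two equations of the resolvent of `N`; each resolvent is then a single
proximal step (`sub_mem_opM`, `sub_mem_opN`). Monotonicity is immediate because the coupling `(L*,
-L)` is skew, and full domain of the resolvents gives maximality by Minty's argument. Convergence is
proved for abstract monotone operators (`IsDouglasRachford.weak_convergence`). The step is firmly
nonexpansive, so `r` is Fejér monotone and the residual `w - z` tends to zero strongly;
`mem_of_weak_limit` identifies weak cluster points of `(r, z)`; an Opial argument shows that the
cluster point is unique. Since the residual vanishes, the limit of `z` is also the limit of the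
other half-step, which Form II needs. -/

namespace PDDR

/-! ### Convex analysis: proximity operators, subgradients, conjugates -/

section ConvexAnalysis

variable {H : Type*} [NormedAddCommGroup H] [InnerProductSpace ℝ H]

/-- The real epigraph of a function in `Γ₀(H)` is closed. -/
theorem Gamma0.isClosed_epigraph {f : H → EReal} (hf : Gamma0 f) :
    IsClosed {p : H × ℝ | f p.1 ≤ (p.2 : EReal)} := by
  have h := hf.lsc.isClosed_epigraph
  exact h.preimage (f := fun p : H × ℝ => (p.1, (p.2 : EReal)))
    (continuous_fst.prodMk (continuous_coe_real_ereal.comp continuous_snd))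

/-- A proper function has a finite value. -/
theorem Gamma0.exists_real {f : H → EReal} (hf : Gamma0 f) : ∃ (x : H) (t : ℝ), f x = t := by
  obtain ⟨x, hx⟩ := hf.exists_ne_top
  exact ⟨x, (f x).toReal, (EReal.coe_toReal hx (hf.ne_bot x)).symm⟩

/-- A function in `Γ₀(H)` has a continuous affine minorant. -/
theorem Gamma0.exists_affine_minorant {f : H → EReal} (hf : Gamma0 f) :
    ∃ (a : H →L[ℝ] ℝ) (b : ℝ), ∀ (y : H) (t : ℝ), f y ≤ (t : EReal) → a y + b ≤ t := by
  obtain ⟨x, t, hx⟩ := hf.exists_real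
  have hnot : ((x, t - 1) : H × ℝ) ∉ {p : H × ℝ | f p.1 ≤ (p.2 : EReal)} := by
    intro h
    have h' : f x ≤ ((t - 1 : ℝ) : EReal) := h
    rw [hx, EReal.coe_le_coe_iff] at h'
    linarith
  obtain ⟨l, s, hs, hl⟩ :=
    geometric_hahn_banach_point_closed hf.convex_epigraph hf.isClosed_epigraph hnot
  have hdec : ∀ (y : H) (r : ℝ), l (y, r) = l (y, 0) + r * l (0, 1) := fun y r => by
    have : ((y, r) : H × ℝ) = (y, 0) + r • (0, 1) := by simp
    rw [this, map_add, map_smul, smul_eq_mul]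
  have hx' := hl (x, t) (by simp [hx])
  rw [hdec] at hs hx'
  -- The separated points `(x, t - 1)` and `(x, t)` lie on one vertical line, so the hyperplane is
  -- not vertical and can be solved for the height.
  have hb : 0 < l (0, 1) := by linarith
  refine ⟨-((l (0, 1))⁻¹ • l.comp (ContinuousLinearMap.inl ℝ H ℝ)), (l (0, 1))⁻¹ * s,
    fun y r hr => ?_⟩
  have h := hl (y, r) hr
  rw [hdec] at h
  have : -((l (0, 1))⁻¹ * l (y, 0)) + (l (0, 1))⁻¹ * s ≤ r := by
    rw [← mul_le_mul_iff_right₀ hb]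
    field_simp
    linarith
  simpa using this

/-- The regularized function attains its infimum over the epigraph. -/
theorem Gamma0.exists_min [CompleteSpace H] {f : H → EReal} (hf : Gamma0 f) {γ : ℝ}
    (hγ : 0 < γ) (w : H) :
    ∃ (p : H) (r : ℝ), f p ≤ (r : EReal) ∧ ∀ (y : H) (t : ℝ), f y ≤ (t : EReal) →
      γ * r + 1 / 2 * ‖w - p‖ ^ 2 ≤ γ * t + 1 / 2 * ‖w - y‖ ^ 2 := by
  set E : Set (H × ℝ) := {p : H × ℝ | f p.1 ≤ (p.2 : EReal)} with hE
  set Φ : H × ℝ → ℝ := fun q => γ * q.2 + 1 / 2 * ‖w - q.1‖ ^ 2 with hΦ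
  obtain ⟨a, b, hab⟩ := hf.exists_affine_minorant
  -- The affine minorant decreases at most linearly in `‖w - y‖`; completing the square gives the
  -- constant.
  have hbdd : BddBelow (Φ '' E) := by
    refine ⟨γ * (a w + b) - 1 / 2 * (γ * ‖a‖) ^ 2, ?_⟩
    rintro _ ⟨⟨y, t⟩, hy, rfl⟩
    have h1 := hab y t hy
    have h2 : a w - a y ≤ ‖a‖ * ‖w - y‖ := by
      rw [← map_sub]; exact (le_abs_self _).trans (a.le_opNorm _)
    have h3 := mul_le_mul_of_nonneg_left h1 hγ.le
    have h4 := mul_le_mul_of_nonneg_left h2 hγ.le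
    simp only [hΦ]
    nlinarith [sq_nonneg (‖w - y‖ - γ * ‖a‖)]
  obtain ⟨x₀, t₀, hx₀⟩ := hf.exists_real
  have hne : (Φ '' E).Nonempty := ⟨_, (x₀, t₀), by simp [hE, hx₀], rfl⟩
  set m := sInf (Φ '' E) with hm
  have hmle : ∀ q ∈ E, m ≤ Φ q := fun q hq => csInf_le hbdd ⟨q, hq, rfl⟩
  have hseq : ∀ n : ℕ, ∃ q ∈ E, Φ q < m + 1 / ((n : ℝ) + 1) := fun n => by
    obtain ⟨_, ⟨q, hq, rfl⟩, hlt⟩ := exists_lt_of_csInf_lt hne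
      (show sInf (Φ '' E) < m + 1 / ((n : ℝ) + 1) by rw [← hm]; linarith [Nat.one_div_pos_of_nat (α := ℝ) (n := n)])
    exact ⟨q, hq, hlt⟩
  choose q hqE hq using hseq
  -- Strong convexity of the quadratic term: `Φ` at the midpoint is at least `m`, and the
  -- parallelogram law bounds the distance of two near-minimizers. Minimizing sequences are
  -- therefore Cauchy in the first component.
  have hmid : ∀ p ∈ E, ∀ p' ∈ E, 1 / 8 * ‖p.1 - p'.1‖ ^ 2 ≤ (Φ p - m) / 2 + (Φ p' - m) / 2 := by
    intro p hp p' hp'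
    have h := hmle _ (hf.convex_epigraph hp hp' (by norm_num : (0 : ℝ) ≤ 1 / 2)
      (by norm_num : (0 : ℝ) ≤ 1 / 2) (by norm_num))
    have e : w - ((1 / 2 : ℝ) • p.1 + (1 / 2 : ℝ) • p'.1)
        = (1 / 2 : ℝ) • ((w - p.1) + (w - p'.1)) := by module
    have e2 : p.1 - p'.1 = (w - p'.1) - (w - p.1) := by abel
    simp only [hΦ, Prod.fst_add, Prod.snd_add, Prod.smul_fst, Prod.smul_snd, e, norm_smul,
      smul_eq_mul] at h ⊢
    rw [e2]
    have := parallelogram_law_with_norm ℝ (w - p'.1) (w - p.1)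
    rw [add_comm (w - p'.1)] at this
    norm_num at h
    nlinarith
  have hlim : Tendsto (fun n : ℕ => 1 / ((n : ℝ) + 1)) atTop (𝓝 0) :=
    tendsto_one_div_add_atTop_nhds_zero_nat
  have hΦlim : Tendsto (fun n => Φ (q n)) atTop (𝓝 m) :=
    tendsto_of_tendsto_of_tendsto_of_le_of_le tendsto_const_nhds
      (by simpa using hlim.const_add m) (fun n => hmle _ (hqE n)) (fun n => (hq n).le)
  have hcau : CauchySeq fun n => (q n).1 := by
    rw [Metric.cauchySeq_iff']
    intro ε hε
    obtain ⟨N, hN⟩ := (hlim.eventually_lt_const (by positivity : (0 : ℝ) < ε ^ 2 / 8)).exists_forall_of_atTop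
    refine ⟨N, fun n hn => ?_⟩
    rw [dist_eq_norm]
    have h1 := hmid _ (hqE n) _ (hqE N)
    have h2 := hq n
    have h3 := hq N
    have h4 := hN n hn
    have h5 := hN N le_rfl
    exact lt_of_pow_lt_pow_left₀ 2 hε.le (by linarith)
  obtain ⟨p, hp⟩ := cauchySeq_tendsto_of_complete hcau
  -- Heights converge too: they are recovered from `Φ (q n)` and `(q n).1`.
  have hr : Tendsto (fun n => (q n).2) atTop (𝓝 (γ⁻¹ * (m - 1 / 2 * ‖w - p‖ ^ 2))) := by
    have := (hΦlim.sub ((((hp.const_sub w).norm).pow 2).const_mul (1 / 2))).const_mul γ⁻¹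
    refine this.congr fun n => ?_
    simp only [hΦ]
    field_simp
    ring
  refine ⟨p, γ⁻¹ * (m - 1 / 2 * ‖w - p‖ ^ 2), ?_, fun y t hy => ?_⟩
  · exact hf.isClosed_epigraph.mem_of_tendsto (hp.prodMk_nhds hr)
      (Eventually.of_forall fun n => by exact hqE n)
  · have := hmle (y, t) hy
    rw [mul_inv_cancel_left₀ hγ.ne']
    simp only [hΦ] at this
    linarith

/-- Subgradients of a proper function exist only where it is finite. -/
theorem subdiff_real {f : H → EReal} (hf : Gamma0 f) {x u : H} (h : u ∈ subdiff f x) :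
    ∃ t : ℝ, f x = t := by
  obtain ⟨y, r, hy⟩ := hf.exists_real
  have h' := h y
  refine ⟨(f x).toReal, (EReal.coe_toReal (fun htop => ?_) (hf.ne_bot x)).symm⟩
  rw [htop, hy, EReal.top_add_coe] at h'
  simp at h'

/-- The inclusion `w ∈ p + γ ∂f(p)` is solvable for every `w`. -/
theorem Gamma0.exists_prox [CompleteSpace H] {f : H → EReal} (hf : Gamma0 f) {γ : ℝ}
    (hγ : 0 < γ) (w : H) : ∃ p, (1 / γ) • (w - p) ∈ subdiff f p := by
  obtain ⟨p, r, hr, hmin⟩ := hf.exists_min hγ w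
  refine ⟨p, fun y => ?_⟩
  have key : ∀ t : ℝ, f y ≤ (t : EReal) → r + inner ℝ (y - p) ((1 / γ) • (w - p)) ≤ t := by
    intro t ht
    rw [real_inner_smul_right]
    -- First-order condition: compare `p` with `p + s (y - p)`, divide by `s`, then let `s` decrease
    -- to zero.
    have hs : ∀ s ∈ Ioo (0 : ℝ) 1,
        0 ≤ γ * (t - r) - inner ℝ (y - p) (w - p) + s * (1 / 2 * ‖y - p‖ ^ 2) := by
      rintro s ⟨hs0, hs1⟩
      have hc := hf.convex_epigraph (show (p, r) ∈ {p : H × ℝ | f p.1 ≤ (p.2 : EReal)} from hr)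
        (show (y, t) ∈ {p : H × ℝ | f p.1 ≤ (p.2 : EReal)} from ht)
        (by linarith : 0 ≤ 1 - s) hs0.le (by ring)
      have h := hmin _ _ hc
      have e : w - ((1 - s) • p + s • y) = (w - p) - s • (y - p) := by module
      simp only [Prod.fst_add, Prod.snd_add, Prod.smul_fst, Prod.smul_snd, e, smul_eq_mul] at h
      rw [norm_sub_sq_real (w - p), norm_smul, real_inner_smul_right, Real.norm_of_nonneg hs0.le,
        real_inner_comm] at h
      have : 0 ≤ s * (γ * (t - r) - inner ℝ (y - p) (w - p) + s * (1 / 2 * ‖y - p‖ ^ 2)) := by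
        linarith
      exact nonneg_of_mul_nonneg_right this hs0
    have hl : Tendsto (fun s : ℝ => γ * (t - r) - inner ℝ (y - p) (w - p)
        + s * (1 / 2 * ‖y - p‖ ^ 2)) (𝓝[>] 0)
        (𝓝 (γ * (t - r) - inner ℝ (y - p) (w - p) + 0 * (1 / 2 * ‖y - p‖ ^ 2))) :=
      (((continuous_id.mul continuous_const).const_add _).tendsto (0 : ℝ)).mono_left
        nhdsWithin_le_nhds
    have h0 := ge_of_tendsto hl (by
      filter_upwards [Ioo_mem_nhdsGT (zero_lt_one (α := ℝ))] with s hs' using hs s hs')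
    rw [zero_mul, add_zero] at h0
    have : 1 / γ * inner ℝ (y - p) (w - p) ≤ t - r := by
      rw [one_div, inv_mul_le_iff₀ hγ]; linarith
    linarith
  have hle : f p + ((inner ℝ (y - p) ((1 / γ) • (w - p)) : ℝ) : EReal)
      ≤ ((r + inner ℝ (y - p) ((1 / γ) • (w - p)) : ℝ) : EReal) := by
    rw [EReal.coe_add]; gcongr
  refine hle.trans ?_
  induction hy : f y with
  | bot => exact absurd hy (hf.ne_bot y)
  | top => exact le_top
  | coe t => exact EReal.coe_le_coe_iff.2 (key t hy.le)

/-- The subgradient characterization of the proximity operator. -/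
theorem prox_eq {f : H → EReal} {γ r : ℝ} (hγ : 0 < γ) {w p : H} (hr : f p = r)
    (h : (1 / γ) • (w - p) ∈ subdiff f p) : prox (scale γ f) w = p := by
  have hsq : ∀ y, ‖w - y‖ ^ 2 = ‖w - p‖ ^ 2 - 2 * inner ℝ (y - p) (w - p) + ‖y - p‖ ^ 2 := by
    intro y
    rw [show w - y = (w - p) - (y - p) by abel, norm_sub_sq_real, real_inner_comm]
  have key : ∀ (y : H) (t : ℝ), f y = t → γ * r + 1 / 2 * ‖w - p‖ ^ 2 + 1 / 2 * ‖y - p‖ ^ 2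
      ≤ γ * t + 1 / 2 * ‖w - y‖ ^ 2 := by
    intro y t ht
    have h1 := h y
    rw [hr, ht, ← EReal.coe_add, EReal.coe_le_coe_iff, real_inner_smul_right, one_div] at h1
    have h2 := mul_le_mul_of_nonneg_left h1 hγ.le
    rw [mul_add, mul_inv_cancel_left₀ hγ.ne'] at h2
    rw [hsq y]
    linarith
  -- Properness comes from the subgradient rather than from `Gamma0`, so the result applies to a
  -- conjugate without showing that it is in `Γ₀(H)`.
  have hbot : ∀ y, f y ≠ ⊥ := fun y hy => by
    have h1 := h y
    rw [hy, hr, ← EReal.coe_add, le_bot_iff] at h1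
    exact EReal.coe_ne_bot _ h1
  have hmin : IsMinOn (fun y => scale γ f y + ((1 / 2 * ‖w - y‖ ^ 2 : ℝ) : EReal)) univ p := by
    intro y _
    simp only [scale, mem_ofPred_eq, hr]
    induction hy : f y with
    | bot => exact absurd hy (hbot y)
    | top => rw [EReal.coe_mul_top_of_pos hγ, EReal.top_add_coe]; exact le_top
    | coe t =>
      rw [← EReal.coe_mul, ← EReal.coe_mul, ← EReal.coe_add, ← EReal.coe_add,
        EReal.coe_le_coe_iff]
      linarith [key y t hy, sq_nonneg ‖y - p‖]
  -- `prox` only selects some minimizer `q`; the surplus `½ ‖q - p‖²` in `key` forces `q = p`.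
  have hprox := Classical.epsilon_spec (p := fun p =>
    IsMinOn (fun y => scale γ f y + ((1 / 2 * ‖w - y‖ ^ 2 : ℝ) : EReal)) univ p) ⟨p, hmin⟩
  change IsMinOn (fun y => scale γ f y + ((1 / 2 * ‖w - y‖ ^ 2 : ℝ) : EReal)) univ
    (prox (scale γ f) w) at hprox
  generalize prox (scale γ f) w = q at hprox
  have h1 := hprox (mem_univ p)
  simp only [scale, mem_ofPred_eq, hr] at h1
  induction hq : f q with
  | bot => exact absurd hq (hbot q)
  | top =>
    rw [hq, EReal.coe_mul_top_of_pos hγ, EReal.top_add_coe, ← EReal.coe_mul, ← EReal.coe_add,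
      top_le_iff] at h1
    exact absurd h1 (EReal.coe_ne_top _)
  | coe t =>
    rw [hq, ← EReal.coe_mul, ← EReal.coe_mul, ← EReal.coe_add, ← EReal.coe_add,
      EReal.coe_le_coe_iff] at h1
    have h2 := key q t hq
    have h3 : ‖q - p‖ ^ 2 ≤ 0 := by linarith
    exact sub_eq_zero.1 (norm_eq_zero.1 (pow_eq_zero_iff two_ne_zero |>.1
      (le_antisymm h3 (sq_nonneg _))))

/-- The subdifferential is monotone. -/
theorem subdiff_monotone {f : H → EReal} (hf : Gamma0 f) {x y u v : H} (hu : u ∈ subdiff f x)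
    (hv : v ∈ subdiff f y) : 0 ≤ inner ℝ (x - y) (u - v) := by
  obtain ⟨s, hs⟩ := subdiff_real hf hu
  obtain ⟨t, ht⟩ := subdiff_real hf hv
  have h1 := hu y
  have h2 := hv x
  rw [hs, ht, ← EReal.coe_add, EReal.coe_le_coe_iff] at h1 h2
  rw [← neg_sub x y, inner_neg_left] at h1
  rw [inner_sub_right]
  linarith

/-- Equality in the Fenchel–Young inequality at a subgradient. -/
theorem conj_eq {f : H → EReal} {x u : H} {t : ℝ} (ht : f x = t) (hu : u ∈ subdiff f x) :
    conj f u = ((inner ℝ u x - t : ℝ) : EReal) := by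
  refine le_antisymm (iSup_le fun y => ?_) ?_
  · have h := hu y
    rw [ht] at h
    induction hy : f y with
    | bot =>
      rw [hy, ← EReal.coe_add, le_bot_iff] at h
      exact absurd h (EReal.coe_ne_bot _)
    | top => simp
    | coe r =>
      rw [hy, ← EReal.coe_add, EReal.coe_le_coe_iff, inner_sub_left, real_inner_comm,
        real_inner_comm u x] at h
      rw [← EReal.coe_sub, EReal.coe_le_coe_iff]
      linarith
  · refine le_trans (le_of_eq ?_) (le_iSup (fun y => ((inner ℝ u y : ℝ) : EReal) - f y) x)
    rw [ht, EReal.coe_sub]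

/-- The Fenchel–Young inequality. -/
theorem le_conj {f : H → EReal} {x : H} {t : ℝ} (ht : f x = t) (u : H) :
    ((inner ℝ u x - t : ℝ) : EReal) ≤ conj f u := by
  refine le_trans (le_of_eq ?_) (le_iSup (fun y => ((inner ℝ u y : ℝ) : EReal) - f y) x)
  rw [ht, EReal.coe_sub]

/-- `u ∈ ∂f(x)` implies `x ∈ ∂f*(u)`. -/
theorem mem_subdiff_conj {f : H → EReal} {x u : H} {t : ℝ} (ht : f x = t)
    (hu : u ∈ subdiff f x) : x ∈ subdiff (conj f) u := by
  intro v
  rw [conj_eq ht hu, ← EReal.coe_add]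
  refine le_trans (le_of_eq ?_) (le_conj ht v)
  rw [inner_sub_left]
  congr 1
  ring

/-- Moreau's decomposition in the form of a resolvent identity: `prox_{σ f*}(w)` is the point `v`
with `v ∈ ∂f((w - v) / σ)`. -/
theorem prox_conj_mem [CompleteSpace H] {f : H → EReal} (hf : Gamma0 f) {σ : ℝ} (hσ : 0 < σ)
    (w : H) : prox (scale σ (conj f)) w
      ∈ subdiff f ((1 / σ) • (w - prox (scale σ (conj f)) w)) := by
  -- Take the proximal point of `f` with parameter `1/σ` at `w/σ`; then `w - σ p` is a subgradient
  -- at `p`, and inverting the subgradient relation makes it the proximal point of `σ f*`.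
  obtain ⟨p, hp⟩ := hf.exists_prox (inv_pos.2 hσ) (σ⁻¹ • w)
  have e1 : (1 / σ⁻¹) • (σ⁻¹ • w - p) = w - σ • p := by
    rw [one_div, inv_inv, smul_sub, smul_inv_smul₀ hσ.ne']
  rw [e1] at hp
  have e2 : (1 / σ) • (w - (w - σ • p)) = p := by
    rw [sub_sub_cancel, one_div, inv_smul_smul₀ hσ.ne']
  obtain ⟨t, ht⟩ := subdiff_real hf hp
  have h : prox (scale σ (conj f)) w = w - σ • p :=
    prox_eq hσ (conj_eq ht hp) (by rw [e2]; exact mem_subdiff_conj ht hp)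
  rw [h, e2]
  exact hp

/-- The optimality condition of `prox_{γ f}`. -/
theorem prox_mem [CompleteSpace H] {f : H → EReal} (hf : Gamma0 f) {γ : ℝ} (hγ : 0 < γ)
    (w : H) : (1 / γ) • (w - prox (scale γ f) w) ∈ subdiff f (prox (scale γ f) w) := by
  obtain ⟨p, hp⟩ := hf.exists_prox hγ w
  obtain ⟨t, ht⟩ := subdiff_real hf hp
  rw [prox_eq hγ ht hp]
  exact hp

end ConvexAnalysis

end PDDR

namespace PDDR

/-! ### Douglas–Rachford iteration in the metric of `P` -/

section DouglasRachford

variable {Z : Type*} [NormedAddCommGroup Z] [InnerProductSpace ℝ Z]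

/-- By Riesz representation, inner products exhaust the continuous functionals. -/
theorem weakTendsto_of_inner [CompleteSpace Z] {x : ℕ → Z} {l : Z}
    (h : ∀ y, Tendsto (fun i => (inner ℝ (x i) y : ℝ)) atTop (𝓝 (inner ℝ l y))) :
    WeakTendsto x l := by
  refine (WeakBilin.tendsto_iff_forall_eval_tendsto (topDualPairing ℝ Z).flip ?_).2 fun φ => ?_
  · intro a b hab
    by_contra hne
    obtain ⟨φ, hφ⟩ := SeparatingDual.exists_separating_of_ne (R := ℝ) hne
    exact hφ (LinearMap.congr_fun hab φ)
  · have := h ((InnerProductSpace.toDual ℝ Z).symm φ)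
    simp_rw [real_inner_comm ((InnerProductSpace.toDual ℝ Z).symm φ),
      InnerProductSpace.toDual_symm_apply] at this
    exact this

/-- A bounded sequence in a Hilbert space has a weak limit along every ultrafilter. -/
theorem exists_weak_limit [CompleteSpace Z] (𝒰 : Ultrafilter ℕ) {x : ℕ → Z} {R : ℝ}
    (hx : ∀ i, ‖x i‖ ≤ R) :
    ∃ l, ∀ y, Tendsto (fun i => (inner ℝ (x i) y : ℝ)) 𝒰 (𝓝 (inner ℝ l y)) := by
  -- Banach–Alaoglu, transported by the Riesz isometry.
  have hK := WeakDual.isCompact_closedBall (𝕜 := ℝ) (E := Z) 0 R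
  obtain ⟨φ, -, hφ⟩ := hK.ultrafilter_le_nhds
    (𝒰.map fun i => StrongDual.toWeakDual (InnerProductSpace.toDual ℝ Z (x i))) (by
      rw [le_principal_iff, Ultrafilter.mem_coe, Ultrafilter.mem_map]
      refine univ_mem' fun i => ?_
      rw [mem_preimage, mem_preimage, StrongDual.toStrongDual_toWeakDual,
        mem_closedBall_zero_iff, LinearIsometryEquiv.norm_map]
      exact hx i)
  refine ⟨(InnerProductSpace.toDual ℝ Z).symm (WeakDual.toStrongDual φ), fun y => ?_⟩
  rw [InnerProductSpace.toDual_symm_apply, WeakDual.toStrongDual_apply]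
  have h := ((WeakDual.eval_continuous y).tendsto φ).mono_left hφ
  rw [Ultrafilter.coe_map, tendsto_map'_iff] at h
  refine h.congr fun i => ?_
  rw [Function.comp_apply, StrongDual.toWeakDual_apply, InnerProductSpace.toDual_apply_apply]

/-- A nonincreasing nonnegative sequence whose weighted sums with divergent weights are controlled
by a telescoping nonnegative sequence tends to zero. -/
theorem tendsto_zero_of_decrease {e φ a : ℕ → ℝ} (he : ∀ i, 0 ≤ e i) (hanti : Antitone e)
    (ha : ∀ i, 0 ≤ a i) (hφ : ∀ i, 0 ≤ φ i) (hdec : ∀ i, φ (i + 1) ≤ φ i - a i * e i)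
    (hsum : Tendsto (fun n => ∑ i ∈ Finset.range n, a i) atTop atTop) :
    Tendsto e atTop (𝓝 0) := by
  -- If `e` stayed above `ε`, the divergent weights would exhaust `φ 0`. One small value suffices by
  -- monotonicity.
  have hex : ∀ ε > 0, ∃ n, e n < ε := by
    intro ε hε
    by_contra! hge
    have hb : ∀ n, ε * ∑ i ∈ Finset.range n, a i ≤ φ 0 - φ n := by
      intro n
      induction n with
      | zero => simp
      | succ n ih =>
        rw [Finset.sum_range_succ, mul_add]
        have := mul_le_mul_of_nonneg_left (hge n) (ha n)
        linarith [hdec n]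
    obtain ⟨n, hn⟩ := (hsum.eventually_gt_atTop (φ 0 / ε)).exists
    rw [div_lt_iff₀ hε] at hn
    linarith [hb n, hφ n]
  rw [Metric.tendsto_atTop]
  intro ε hε
  obtain ⟨N, hN⟩ := hex ε hε
  refine ⟨N, fun n hn => ?_⟩
  rw [Real.dist_eq, sub_zero, abs_of_nonneg (he n)]
  exact (hanti hn).trans_lt hN

variable {P : Z →L[ℝ] Z} {A B : Z → Set Z}

theorem StronglyPositive.exists_lower_bound (hP : StronglyPositive P) :
    ∃ a : ℝ, 0 < a ∧ ∀ x, a * ‖x‖ ^ 2 ≤ inner ℝ x (P x) := by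
  obtain ⟨a, ha, h⟩ := hP
  refine ⟨a, ha, fun x => ?_⟩
  have := h.inner_nonneg_right x
  simp only [sub_apply, smul_apply,
    ContinuousLinearMap.id_apply, inner_sub_right, real_inner_smul_right,
    real_inner_self_eq_norm_sq] at this
  linarith

theorem StronglyPositive.nonneg (hP : StronglyPositive P) (x : Z) : 0 ≤ (inner ℝ x (P x) : ℝ) := by
  obtain ⟨a, ha, h⟩ := hP.exists_lower_bound
  exact le_trans (by positivity) (h x)

theorem StronglyPositive.eq_zero (hP : StronglyPositive P) {x : Z}
    (hx : (inner ℝ x (P x) : ℝ) ≤ 0) : x = 0 := by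
  obtain ⟨a, ha, h⟩ := hP.exists_lower_bound
  by_contra hne
  have : 0 < a * ‖x‖ ^ 2 := by have := norm_pos_iff.2 hne; positivity
  linarith [h x]

/-- The resolvent of a monotone operator is at most single-valued. -/
theorem resolvent_unique (hP : StronglyPositive P) (hA : MonotoneIn P A) {r z z' : Z}
    (hz : r - z ∈ A z) (hz' : r - z' ∈ A z') : z = z' := by
  have h := hA _ _ _ hz _ hz'
  rw [sub_sub_sub_cancel_left, ← neg_sub z z', map_neg, inner_neg_right] at h
  exact sub_eq_zero.1 (hP.eq_zero (by linarith))

theorem mem_resolvent_iff {E : Type*} [NormedAddCommGroup E] {A : E → Set E} {r z : E} :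
    z ∈ resolvent A r ↔ r - z ∈ A z := by
  simp [resolvent, opInv, sub_eq_add_neg]

theorem resolvent_eq_singleton (hP : StronglyPositive P) (hA : MonotoneIn P A) {r z : Z}
    (hz : r - z ∈ A z) : resolvent A r = {z} := by
  ext z'
  rw [mem_resolvent_iff, mem_singleton_iff]
  exact ⟨fun h => resolvent_unique hP hA h hz, fun h => h ▸ hz⟩

/-- A monotone operator whose resolvent has full domain is maximally monotone. -/
theorem maxMonotoneIn_of_surjective (hP : StronglyPositive P) (hA : MonotoneIn P A)
    (hs : ∀ r, ∃ z, r - z ∈ A z) : MaxMonotoneIn P A := by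
  refine ⟨hA, fun B hB hAB => funext fun z => (subset_antisymm ?_ (hAB z))⟩
  intro v hv
  -- Minty's argument: `z` and `z'` both resolve `z + v` for the extension `B`, hence coincide, and
  -- `v` already belongs to `A z`.
  obtain ⟨z', hz'⟩ := hs (z + v)
  have : z = z' := resolvent_unique hP hB (r := z + v) (by simpa using hv) (hAB _ hz')
  subst this
  simpa using hz'

theorem inner_comm_of_isSelfAdjoint [CompleteSpace Z] (hsa : IsSelfAdjoint P) (x y : Z) :
    (inner ℝ x (P y) : ℝ) = inner ℝ y (P x) := by
  rw [← ContinuousLinearMap.adjoint_inner_left, hsa.adjoint_eq, real_inner_comm]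

/-- The Douglas–Rachford step `r ↦ r + (w - z)` is firmly nonexpansive. -/
theorem douglasRachford_firm [CompleteSpace Z] (hsa : IsSelfAdjoint P)
    (hA : MonotoneIn P A) (hB : MonotoneIn P B) {r z w r' z' w' : Z}
    (hz : r - z ∈ A z) (hw : (2 : ℝ) • z - r - w ∈ B w)
    (hz' : r' - z' ∈ A z') (hw' : (2 : ℝ) • z' - r' - w' ∈ B w') :
    (inner ℝ (r - r') (P ((w - z) - (w' - z'))) : ℝ)
      ≤ -inner ℝ ((w - z) - (w' - z')) (P ((w - z) - (w' - z'))) := by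
  have h1 := hA _ _ _ hz _ hz'
  have h2 := hB _ _ _ hw _ hw'
  -- In terms of the differences of `r`, `z` and `w - z`, adding the two monotonicity inequalities
  -- cancels everything containing `z - z'`.
  have e1 : r - z - (r' - z') = (r - r') - (z - z') := by abel
  have e2 : (2 : ℝ) • z - r - w - ((2 : ℝ) • z' - r' - w')
      = (z - z') - (r - r') - ((w - z) - (w' - z')) := by module
  have e3 : w - w' = (z - z') + ((w - z) - (w' - z')) := by abel
  rw [e1] at h1
  rw [e2, e3] at h2
  generalize r - r' = a at *
  generalize z - z' = b at *
  generalize (w - z) - (w' - z') = d at *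
  simp only [map_sub, inner_sub_right, inner_add_left] at h1 h2
  rw [inner_comm_of_isSelfAdjoint hsa a d]
  rw [inner_comm_of_isSelfAdjoint hsa b d] at h2
  linarith

/-- The resolvent of a monotone operator is nonexpansive. -/
theorem resolvent_nonexpansive [CompleteSpace Z] (hsa : IsSelfAdjoint P) (hP : StronglyPositive P)
    (hA : MonotoneIn P A) {r z r' z' : Z} (hz : r - z ∈ A z) (hz' : r' - z' ∈ A z') :
    (inner ℝ (z - z') (P (z - z')) : ℝ) ≤ inner ℝ (r - r') (P (r - r')) := by
  have h1 := hA _ _ _ hz _ hz'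
  have e1 : r - z - (r' - z') = (r - r') - (z - z') := by abel
  rw [e1] at h1
  have h2 := hP.nonneg ((r - r') - (z - z'))
  generalize r - r' = a at *
  generalize z - z' = b at *
  simp only [map_sub, inner_sub_right, inner_sub_left] at h1 h2
  rw [inner_comm_of_isSelfAdjoint hsa a b] at h2
  linarith

/-- Demiclosedness: a weak limit of asymptotically consistent points of the graphs of `A` and `B`
whose images sum to zero asymptotically solves the inclusion. -/
theorem mem_of_weak_limit [CompleteSpace Z] (hsa : IsSelfAdjoint P) (hP : StronglyPositive P)
    (hA : MonotoneIn P A) (hB : MonotoneIn P B)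
    (hAs : ∀ r, ∃ z, r - z ∈ A z) (hBs : ∀ r, ∃ z, r - z ∈ B z)
    {l : Filter ℕ} [l.NeBot] {r z w : ℕ → Z} {r' z' : Z}
    (hz : ∀ i, r i - z i ∈ A (z i)) (hw : ∀ i, (2 : ℝ) • z i - r i - w i ∈ B (w i))
    {R : ℝ} (hrb : ∀ i, ‖r i‖ ≤ R)
    (hd : Tendsto (fun i => w i - z i) l (𝓝 0))
    (hr : ∀ y, Tendsto (fun i => (inner ℝ (r i) y : ℝ)) l (𝓝 (inner ℝ r' y)))
    (hzl : ∀ y, Tendsto (fun i => (inner ℝ (z i) y : ℝ)) l (𝓝 (inner ℝ z' y))) :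
    r' - z' ∈ A z' ∧ z' - r' ∈ B z' := by
  -- Test points: if the claim holds, both resolvents must return `z'`.
  obtain ⟨x, hx⟩ := hAs r'
  obtain ⟨y, hy⟩ := hBs ((2 : ℝ) • z' - r')
  have hbz : ∀ (b : ℕ → Z) (C : ℝ), (∀ i, ‖b i‖ ≤ C) →
      Tendsto (fun i => (inner ℝ (b i) (P (w i - z i)) : ℝ)) l (𝓝 0) := by
    intro b C hb
    have hPd : Tendsto (fun i => C * ‖P (w i - z i)‖) l (𝓝 0) := by
      have h := ((P.continuous.norm.tendsto 0).comp hd).const_mul C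
      simpa using h
    refine squeeze_zero_norm (fun i => ?_) hPd
    exact (norm_inner_le_norm _ _).trans (mul_le_mul_of_nonneg_right (hb i) (norm_nonneg _))
  have hdy : ∀ v, Tendsto (fun i => (inner ℝ (w i - z i) v : ℝ)) l (𝓝 0) := fun v => by
    have h := hd.inner (𝕜 := ℝ) (tendsto_const_nhds (x := v))
    rwa [inner_zero_left] at h
  have hdd : Tendsto (fun i => (inner ℝ (w i - z i) (P (w i - z i)) : ℝ)) l (𝓝 0) := by
    have h := hd.inner (𝕜 := ℝ) ((P.continuous.tendsto 0).comp hd)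
    rwa [inner_zero_left] at h
  -- Neither monotonicity inequality passes to a weak limit alone. In their sum the products among
  -- `r i` and `z i` cancel, leaving terms affine in the iterates and terms containing the strongly
  -- vanishing `w i - z i`.
  have hsum : ∀ i, 0 ≤ -inner ℝ (r i) (P (w i - z i)) - inner ℝ (w i - z i) (P (w i - z i))
      + inner ℝ y (P (w i - z i))
      - inner ℝ (w i - z i) (P ((2 : ℝ) • z' - r' - y))
      - inner ℝ (r i) (P x) + inner ℝ (z i) (P x)
      - inner ℝ (z i) (P (r' - x)) + inner ℝ x (P (r' - x))
      + inner ℝ (r i) (P y) - inner ℝ (z i) (P y)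
      - inner ℝ (z i) (P ((2 : ℝ) • z' - r' - y)) + inner ℝ y (P ((2 : ℝ) • z' - r' - y)) := by
    intro i
    have h1 := hA _ _ _ (hz i) _ hx
    have h2 := hB _ _ _ (hw i) _ hy
    have e : (2 : ℝ) • z i - r i - w i - ((2 : ℝ) • z' - r' - y)
      = (z i - r i) - (w i - z i) - ((2 : ℝ) • z' - r' - y) := by module
    have e3 : w i - y = z i + (w i - z i) - y := by abel
    rw [e, e3] at h2
    generalize w i - z i = d at *
    generalize (2 : ℝ) • z' - r' - y = v at *
    generalize r' - x = u at *
    simp only [map_sub, inner_sub_right, inner_sub_left, inner_add_left] at h1 h2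
    have c1 := inner_comm_of_isSelfAdjoint hsa d (z i)
    have c2 := inner_comm_of_isSelfAdjoint hsa d (r i)
    have c3 := inner_comm_of_isSelfAdjoint hsa x (z i)
    have c4 := inner_comm_of_isSelfAdjoint hsa x (r i)
    have c5 := inner_comm_of_isSelfAdjoint hsa y (z i)
    have c6 := inner_comm_of_isSelfAdjoint hsa y (r i)
    linarith
  have hlim := (((((((((((hbz r R hrb).neg.sub hdd).add (hbz (fun _ => y) ‖y‖ fun _ => le_rfl)).sub
    (hdy (P ((2 : ℝ) • z' - r' - y)))).sub (hr (P x))).add (hzl (P x))).sub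
    (hzl (P (r' - x)))).add (tendsto_const_nhds (x := inner ℝ x (P (r' - x))))).add
    (hr (P y))).sub (hzl (P y))).sub (hzl (P ((2 : ℝ) • z' - r' - y)))).add
    (tendsto_const_nhds (x := inner ℝ y (P ((2 : ℝ) • z' - r' - y))))
  have h0 := ge_of_tendsto hlim (Eventually.of_forall hsum)
  -- The limit inequality is minus the sum of two squared `P`-distances, so `x = y = z'`.
  have hxy : (inner ℝ (x - z') (P (x - z')) : ℝ) + inner ℝ (y - z') (P (y - z')) ≤ 0 := by
    simp only [map_sub, map_smul, inner_sub_right, inner_sub_left, real_inner_smul_right] at h0 ⊢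
    have c1 := inner_comm_of_isSelfAdjoint hsa x z'
    have c2 := inner_comm_of_isSelfAdjoint hsa y z'
    have c3 := inner_comm_of_isSelfAdjoint hsa r' z'
    have c4 := inner_comm_of_isSelfAdjoint hsa r' x
    have c5 := inner_comm_of_isSelfAdjoint hsa r' y
    linarith
  have hx' : x = z' := sub_eq_zero.1 (hP.eq_zero (by linarith [hP.nonneg (y - z')]))
  have hy' : y = z' := sub_eq_zero.1 (hP.eq_zero (by linarith [hP.nonneg (x - z')]))
  subst hx'
  subst hy'
  refine ⟨hx, ?_⟩
  convert hy using 1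
  module

/-- Weak convergence of the relaxed Douglas–Rachford iteration, shadow sequence included. -/
theorem IsDouglasRachford.weak_convergence [CompleteSpace Z] (hsa : IsSelfAdjoint P)
    (hP : StronglyPositive P) (hA : MonotoneIn P A) (hB : MonotoneIn P B)
    (hAs : ∀ r, ∃ z, r - z ∈ A z) (hBs : ∀ r, ∃ z, r - z ∈ B z)
    (hzero : ∃ z, ∃ a ∈ A z, -a ∈ B z) {ρ : ℕ → ℝ} (hρ : ∀ i, ρ i ∈ Icc (0 : ℝ) 2)
    (hρsum : Tendsto (fun n => ∑ i ∈ Finset.range n, ρ i * (2 - ρ i)) atTop atTop)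
    {r z w : ℕ → Z} (h : IsDouglasRachford A B ρ r z w) :
    ∃ z', (∃ a ∈ A z', -a ∈ B z') ∧
      (∀ y, Tendsto (fun i => (inner ℝ (z i) y : ℝ)) atTop (𝓝 (inner ℝ z' y))) ∧
      Tendsto (fun i => w i - z i) atTop (𝓝 0) := by
  have hz : ∀ i, r i - z i ∈ A (z i) := fun i =>
    mem_resolvent_iff.1 (by rw [h.z_eq i]; rfl)
  have hw : ∀ i, (2 : ℝ) • z i - r i - w i ∈ B (w i) := fun i =>
    mem_resolvent_iff.1 (by rw [h.w_eq i]; rfl)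
  have hρa : ∀ i, 0 ≤ ρ i * (2 - ρ i) := fun i =>
    mul_nonneg (hρ i).1 (by linarith [(hρ i).2])
  -- The pair `(r', z')` encodes a fixed point, with `w' = z'`; firm nonexpansiveness against it
  -- yields the decrease with factor `ρ (2 - ρ)`.
  have hfejer : ∀ r' z', r' - z' ∈ A z' → z' - r' ∈ B z' → ∀ i,
      (inner ℝ (r (i + 1) - r') (P (r (i + 1) - r')) : ℝ) ≤ inner ℝ (r i - r') (P (r i - r'))
        - ρ i * (2 - ρ i) * inner ℝ (w i - z i) (P (w i - z i)) := by
    intro r' z' ha hb i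
    have h1 := douglasRachford_firm hsa hA hB (hz i) (hw i) ha (w' := z')
      (by convert hb using 1; module)
    rw [sub_self, sub_zero] at h1
    have e : r (i + 1) - r' = (r i - r') + ρ i • (w i - z i) := by rw [h.s_succ]; abel
    rw [e]
    have c := inner_comm_of_isSelfAdjoint hsa (w i - z i) (r i - r')
    generalize r i - r' = a at *
    generalize w i - z i = d at *
    simp only [map_add, map_smul, inner_add_left, inner_add_right, real_inner_smul_left,
      real_inner_smul_right, c]
    nlinarith [mul_le_mul_of_nonneg_left h1 (hρ i).1]
  have hfix : ∀ r' z', r' - z' ∈ A z' → z' - r' ∈ B z' → ∀ i,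
      (inner ℝ (r (i + 1) - r') (P (r (i + 1) - r')) : ℝ)
        ≤ inner ℝ (r i - r') (P (r i - r')) := fun r' z' ha hb i => by
    have h1 := hfejer r' z' ha hb i
    have h2 := mul_nonneg (hρa i) (hP.nonneg (w i - z i))
    linarith
  have hanti : ∀ r' z', r' - z' ∈ A z' → z' - r' ∈ B z' →
      Antitone fun i => (inner ℝ (r i - r') (P (r i - r')) : ℝ) := fun r' z' ha hb =>
    antitone_nat_of_succ_le (hfix r' z' ha hb)
  -- Relaxations may approach `0` or `2`, so summability alone does not send the residual to zero;
  -- its monotonicity closes the gap.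
  have hdanti : Antitone fun i => (inner ℝ (w i - z i) (P (w i - z i)) : ℝ) := by
    refine antitone_nat_of_succ_le fun i => ?_
    have h1 := douglasRachford_firm hsa hA hB (hz (i + 1)) (hw (i + 1)) (hz i) (hw i)
    have e : r (i + 1) - r i = ρ i • (w i - z i) := by rw [h.s_succ]; abel
    rw [e] at h1
    have e2 : w (i + 1) - z (i + 1) = (w i - z i) + (w (i + 1) - z (i + 1) - (w i - z i)) := by
      abel
    rw [e2]
    have hn := hP.nonneg (w (i + 1) - z (i + 1) - (w i - z i))
    have hzero' := fun hh => hP.eq_zero (x := w (i + 1) - z (i + 1) - (w i - z i)) hh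
    generalize w (i + 1) - z (i + 1) - (w i - z i) = D at *
    generalize w i - z i = d at *
    rw [real_inner_smul_left] at h1
    obtain ⟨h0, h2⟩ := hρ i
    rcases h0.eq_or_lt with h0 | h0
    · rw [← h0, zero_mul] at h1
      have hD : D = 0 := hzero' (by linarith)
      simp [hD]
    · have c := inner_comm_of_isSelfAdjoint hsa D d
      simp only [map_add, inner_add_left, inner_add_right, c]
      have : (2 * inner ℝ d (P D) + inner ℝ D (P D) : ℝ) ≤ 0 := by
        refine nonpos_of_mul_nonpos_right (a := ρ i) ?_ h0
        nlinarith [mul_nonneg (sub_nonneg.2 h2) hn]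
      linarith
  obtain ⟨z₀, a₀, ha₀, hb₀⟩ := hzero
  have hA₀ : (z₀ + a₀) - z₀ ∈ A z₀ := by simpa using ha₀
  have hB₀ : z₀ - (z₀ + a₀) ∈ B z₀ := by simpa using hb₀
  obtain ⟨a, ha, hlow⟩ := hP.exists_lower_bound
  have hdN : Tendsto (fun i => (inner ℝ (w i - z i) (P (w i - z i)) : ℝ)) atTop (𝓝 0) :=
    tendsto_zero_of_decrease (fun i => hP.nonneg _) hdanti hρa
      (fun i => hP.nonneg (r i - (z₀ + a₀)))
      (hfejer _ _ hA₀ hB₀) hρsum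
  have hd : Tendsto (fun i => w i - z i) atTop (𝓝 0) := by
    rw [tendsto_zero_iff_norm_tendsto_zero]
    have h1 : Tendsto (fun i => ‖w i - z i‖ ^ 2) atTop (𝓝 0) := by
      refine squeeze_zero (fun i => by positivity) (fun i => ?_) (by simpa only [mul_zero] using hdN.const_mul a⁻¹)
      rw [le_inv_mul_iff₀ ha]
      exact hlow _
    simpa using h1.sqrt
  set C := (inner ℝ (r 0 - (z₀ + a₀)) (P (r 0 - (z₀ + a₀))) : ℝ)
  have hbound : ∀ x : Z, (inner ℝ x (P x) : ℝ) ≤ C → ‖x‖ ≤ √(C / a) := fun x hx =>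
    Real.le_sqrt_of_sq_le (by rw [le_div_iff₀ ha]; linarith [hlow x])
  have hrC : ∀ i, (inner ℝ (r i - (z₀ + a₀)) (P (r i - (z₀ + a₀))) : ℝ) ≤ C := fun i =>
    hanti _ _ hA₀ hB₀ (Nat.zero_le i)
  have hrb : ∀ i, ‖r i‖ ≤ √(C / a) + ‖z₀ + a₀‖ := fun i => by
    have h1 := hbound _ (hrC i)
    have h2 := norm_le_norm_sub_add (r i) (z₀ + a₀)
    linarith
  have hzb : ∀ i, ‖z i‖ ≤ √(C / a) + ‖z₀‖ := fun i => by
    have h1 := hbound _ ((resolvent_nonexpansive hsa hP hA (hz i) hA₀).trans (hrC i))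
    have h2 := norm_le_norm_sub_add (z i) z₀
    linarith
  have hcluster : ∀ 𝒰 : Ultrafilter ℕ, (𝒰 : Filter ℕ) ≤ atTop → ∃ r' z',
      (r' - z' ∈ A z' ∧ z' - r' ∈ B z') ∧
      (∀ y, Tendsto (fun i => (inner ℝ (r i) y : ℝ)) 𝒰 (𝓝 (inner ℝ r' y))) ∧
      ∀ y, Tendsto (fun i => (inner ℝ (z i) y : ℝ)) 𝒰 (𝓝 (inner ℝ z' y)) := by
    intro 𝒰 h𝒰
    obtain ⟨r', hr'⟩ := exists_weak_limit 𝒰 hrb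
    obtain ⟨z', hz'⟩ := exists_weak_limit 𝒰 hzb
    exact ⟨r', z', mem_of_weak_limit hsa hP hA hB hAs hBs hz hw hrb (hd.mono_left h𝒰) hr' hz',
      hr', hz'⟩
  have hconv : ∀ r' z', r' - z' ∈ A z' → z' - r' ∈ B z' →
      ∃ α, Tendsto (fun i => (inner ℝ (r i - r') (P (r i - r')) : ℝ)) atTop (𝓝 α) :=
    fun r' z' h1 h2 => ⟨_, tendsto_atTop_ciInf (hanti r' z' h1 h2)
      ⟨0, by rintro _ ⟨i, rfl⟩; exact hP.nonneg _⟩⟩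
  obtain ⟨𝒰₀, h𝒰₀⟩ := Ultrafilter.exists_le (atTop : Filter ℕ)
  obtain ⟨r', z', ⟨hA', hB'⟩, hr', hz'⟩ := hcluster 𝒰₀ h𝒰₀
  refine ⟨z', ⟨r' - z', hA', by rwa [neg_sub]⟩, fun y => ?_, hd⟩
  rw [tendsto_iff_ultrafilter]
  intro 𝒰 h𝒰
  obtain ⟨r'', z'', ⟨hA'', hB''⟩, hr'', hz''⟩ := hcluster 𝒰 h𝒰
  obtain ⟨α, hα⟩ := hconv r' z' hA' hB'
  obtain ⟨β, hβ⟩ := hconv r'' z'' hA'' hB''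
  -- Opial's argument: the difference of the two convergent squared distances is affine in `r i`.
  -- Evaluating the limit along both ultrafilters gives `r'' = r'`.
  have hγ : Tendsto (fun i => (inner ℝ (r i) (P (r'' - r')) : ℝ)) atTop
      (𝓝 (2⁻¹ * (α - β - (inner ℝ r' (P r') - inner ℝ r'' (P r''))))) := by
    refine (((hα.sub hβ).sub_const (inner ℝ r' (P r') - inner ℝ r'' (P r''))).const_mul
      2⁻¹).congr fun i => ?_
    simp only [map_sub, inner_sub_left, inner_sub_right]
    have c1 := inner_comm_of_isSelfAdjoint hsa r' (r i)
    have c2 := inner_comm_of_isSelfAdjoint hsa r'' (r i)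
    rw [c1, c2]
    ring
  have e1 := tendsto_nhds_unique (hγ.mono_left h𝒰₀) (hr' _)
  have e2 := tendsto_nhds_unique (hγ.mono_left h𝒰) (hr'' _)
  have hrr : r'' = r' := sub_eq_zero.1 (hP.eq_zero (by
    rw [inner_sub_left, ← e1, ← e2, sub_self]))
  subst hrr
  rw [resolvent_unique hP hA hA' hA'']
  exact hz'' y

end DouglasRachford

end PDDR

namespace PDDR

/-! ### The operators `M` and `N` and the optimality system -/

section PrimalDual

variable {X U : Type*} [NormedAddCommGroup X] [InnerProductSpace ℝ X]
  [NormedAddCommGroup U] [InnerProductSpace ℝ U]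

theorem weakTendsto_fst [CompleteSpace X] {z : ℕ → WithLp 2 (X × U)} {l : WithLp 2 (X × U)}
    (h : ∀ y, Tendsto (fun i => (inner ℝ (z i) y : ℝ)) atTop (𝓝 (inner ℝ l y))) :
    WeakTendsto (fun i => (z i).fst) l.fst :=
  weakTendsto_of_inner fun y => by simpa using h (WithLp.toLp 2 (y, 0))

theorem weakTendsto_snd [CompleteSpace U] {z : ℕ → WithLp 2 (X × U)} {l : WithLp 2 (X × U)}
    (h : ∀ y, Tendsto (fun i => (inner ℝ (z i) y : ℝ)) atTop (𝓝 (inner ℝ l y))) :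
    WeakTendsto (fun i => (z i).snd) l.snd :=
  weakTendsto_of_inner fun y => by simpa using h (WithLp.toLp 2 (0, y))

/-- The subgradient inequality for the convex quadratic `h`. -/
theorem le_quad {Q : X →L[ℝ] X} (hQ : Q.IsPositive) (c x y : X) :
    1 / 2 * inner ℝ x (Q x) + inner ℝ x c + inner ℝ (y - x) (Q x + c)
      ≤ (1 / 2 * inner ℝ y (Q y) + inner ℝ y c : ℝ) := by
  have h := hQ.inner_nonneg_right (y - x)
  have hs : (inner ℝ x (Q y) : ℝ) = inner ℝ y (Q x) := by
    rw [← hQ.inner_left_eq_inner_right, real_inner_comm]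
  simp only [map_sub, inner_sub_left, inner_sub_right, inner_add_right] at h ⊢
  linarith

variable [CompleteSpace X] [CompleteSpace U]

@[simp]
theorem precond_fst (L : X →L[ℝ] U) (Q : X →L[ℝ] X) (τ σ : ℝ) (z : WithLp 2 (X × U)) :
    (precond L Q τ σ z).fst = (1 / τ) • z.fst - (1 / 2 : ℝ) • Q z.fst := rfl

@[simp]
theorem precond_snd (L : X →L[ℝ] U) (Q : X →L[ℝ] X) (τ σ : ℝ) (z : WithLp 2 (X × U)) :
    (precond L Q τ σ z).snd
      = (1 / σ) • z.snd - τ • L (ContinuousLinearMap.adjoint L z.snd) := rfl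

theorem precond_isSelfAdjoint {L : X →L[ℝ] U} {Q : X →L[ℝ] X} (hQ : Q.IsPositive) (τ σ : ℝ) :
    IsSelfAdjoint (precond L Q τ σ) := by
  rw [ContinuousLinearMap.isSelfAdjoint_iff_isSymmetric]
  intro x y
  have hs := hQ.inner_left_eq_inner_right x.fst y.fst
  have hL : (inner ℝ (L (ContinuousLinearMap.adjoint L x.snd)) y.snd : ℝ)
      = inner ℝ x.snd (L (ContinuousLinearMap.adjoint L y.snd)) := by
    rw [← ContinuousLinearMap.adjoint_inner_right, ContinuousLinearMap.adjoint_inner_left]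
  simp [WithLp.prod_inner_apply, inner_sub_left, inner_sub_right, real_inner_smul_left,
    real_inner_smul_right, hs, hL]

/-- `P` is block diagonal, and each step-size condition is exactly the positivity margin of one
block; the smaller margin serves as the constant. -/
theorem precond_stronglyPositive {L : X →L[ℝ] U} {Q : X →L[ℝ] X} (hQ : Q.IsPositive) {τ σ : ℝ}
    (hτ : 0 < τ) (hσ : 0 < σ) (hτQ : τ * ‖Q‖ < 2) (hστ : σ * τ * ‖L‖ ^ 2 < 1) :
    StronglyPositive (precond L Q τ σ) := by
  have h1 : 0 < 1 / τ - ‖Q‖ / 2 := by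
    rw [sub_pos, div_lt_div_iff₀ two_pos hτ]; linarith
  have h2 : 0 < 1 / σ - τ * ‖L‖ ^ 2 := by
    rw [sub_pos, lt_div_iff₀ hσ]; linarith
  refine ⟨min (1 / τ - ‖Q‖ / 2) (1 / σ - τ * ‖L‖ ^ 2), lt_min h1 h2, ?_⟩
  set a := min (1 / τ - ‖Q‖ / 2) (1 / σ - τ * ‖L‖ ^ 2)
  have ha1 : a ≤ 1 / τ - ‖Q‖ / 2 := min_le_left _ _
  have ha2 : a ≤ 1 / σ - τ * ‖L‖ ^ 2 := min_le_right _ _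
  rw [ContinuousLinearMap.isPositive_def']
  refine ⟨(precond_isSelfAdjoint hQ τ σ).sub (.smul (.all a) (.one _)), fun x => ?_⟩
  have hq : (inner ℝ (Q x.fst) x.fst : ℝ) ≤ ‖Q‖ * ‖x.fst‖ ^ 2 := by
    calc (inner ℝ (Q x.fst) x.fst : ℝ) ≤ ‖Q x.fst‖ * ‖x.fst‖ := real_inner_le_norm _ _
      _ ≤ ‖Q‖ * ‖x.fst‖ * ‖x.fst‖ := by gcongr; exact Q.le_opNorm _
      _ = _ := by ring
  have hl : (inner ℝ (L (ContinuousLinearMap.adjoint L x.snd)) x.snd : ℝ)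
      ≤ ‖L‖ ^ 2 * ‖x.snd‖ ^ 2 := by
    rw [← ContinuousLinearMap.adjoint_inner_right, real_inner_self_eq_norm_sq, ← mul_pow]
    gcongr
    simpa using (ContinuousLinearMap.adjoint L).le_opNorm x.snd
  rw [ContinuousLinearMap.reApplyInnerSelf_apply, RCLike.re_to_real, sub_apply, smul_apply,
    ContinuousLinearMap.id_apply, WithLp.prod_inner_apply]
  simp only [WithLp.ofLp_sub, WithLp.ofLp_smul, Prod.fst_sub, Prod.snd_sub, Prod.smul_fst,
    Prod.smul_snd, inner_sub_left, real_inner_smul_left]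
  change 0 ≤ (inner ℝ (precond L Q τ σ x).fst x.fst : ℝ) - a * inner ℝ x.fst x.fst
    + (inner ℝ (precond L Q τ σ x).snd x.snd - a * inner ℝ x.snd x.snd)
  simp only [precond_fst, precond_snd, inner_sub_left, real_inner_smul_left,
    real_inner_self_eq_norm_sq]
  nlinarith [mul_le_mul_of_nonneg_right ha1 (sq_nonneg ‖x.fst‖),
    mul_le_mul_of_nonneg_right ha2 (sq_nonneg ‖x.snd‖), mul_le_mul_of_nonneg_left hl hτ.le]

/-- A strongly positive operator is surjective. -/
theorem StronglyPositive.surjective {Z : Type*} [NormedAddCommGroup Z] [InnerProductSpace ℝ Z]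
    [CompleteSpace Z] {P : Z →L[ℝ] Z} (hP : StronglyPositive P) : Function.Surjective P := by
  obtain ⟨a, ha, h⟩ := hP.exists_lower_bound
  -- Lax–Milgram.
  have hc : IsCoercive ((innerSL ℝ).comp P) :=
    ⟨a, ha, fun u => by
      change a * ‖u‖ * ‖u‖ ≤ (inner ℝ (P u) u : ℝ)
      rw [real_inner_comm, mul_assoc, ← sq]
      exact h u⟩
  have he : ∀ u, hc.continuousLinearEquivOfBilin u = P u := fun u =>
    ext_inner_right ℝ fun v => hc.continuousLinearEquivOfBilin_apply u v
  intro y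
  obtain ⟨x, hx⟩ := hc.continuousLinearEquivOfBilin.surjective y
  exact ⟨x, by rw [← he, hx]⟩

theorem mem_opM {f : X → EReal} {L : X →L[ℝ] U} {Q : X →L[ℝ] X} {c : X} {τ σ : ℝ}
    {z v : WithLp 2 (X × U)} :
    v ∈ opM f L Q c τ σ z ↔ (∃ ξ ∈ subdiff f z.fst,
      (precond L Q τ σ v).fst = ξ + ((1 / 2 : ℝ) • Q z.fst + c)) ∧
      (precond L Q τ σ v).snd = 0 := by
  simp only [opM, mem_preimage, mem_ofPred_eq, Set.mem_add, mem_singleton_iff, exists_eq_left, eq_comm]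

theorem mem_opN {g : U → EReal} {L : X →L[ℝ] U} {Q : X →L[ℝ] X} {τ σ : ℝ}
    {z v : WithLp 2 (X × U)} :
    v ∈ opN g L Q τ σ z ↔
      (precond L Q τ σ v).fst = (1 / 2 : ℝ) • Q z.fst + ContinuousLinearMap.adjoint L z.snd ∧
      ∃ p, z.snd ∈ subdiff g p ∧ (precond L Q τ σ v).snd = -(L z.fst) + p := by
  simp only [opN, mem_preimage, mem_ofPred_eq, Set.mem_add, mem_singleton_iff, exists_eq_left, eq_comm,
    opInv]

theorem opM_monotone {f : X → EReal} (hf : Gamma0 f) (L : X →L[ℝ] U) {Q : X →L[ℝ] X}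
    (hQ : Q.IsPositive) (c : X) (τ σ : ℝ) : MonotoneIn (precond L Q τ σ) (opM f L Q c τ σ) := by
  intro z z' v hv v' hv'
  obtain ⟨⟨ξ, hξ, h1⟩, h2⟩ := mem_opM.1 hv
  obtain ⟨⟨ξ', hξ', h1'⟩, h2'⟩ := mem_opM.1 hv'
  have hm := subdiff_monotone hf hξ hξ'
  have hq := hQ.inner_nonneg_right (z.fst - z'.fst)
  rw [map_sub, WithLp.prod_inner_apply]
  change 0 ≤ (inner ℝ (z.fst - z'.fst)
      ((precond L Q τ σ v).fst - (precond L Q τ σ v').fst) : ℝ)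
    + inner ℝ (z.snd - z'.snd) ((precond L Q τ σ v).snd - (precond L Q τ σ v').snd)
  rw [h1, h1', h2, h2', sub_zero, inner_zero_right, add_zero,
    show ξ + ((1 / 2 : ℝ) • Q z.fst + c) - (ξ' + ((1 / 2 : ℝ) • Q z'.fst + c))
      = (ξ - ξ') + (1 / 2 : ℝ) • Q (z.fst - z'.fst) by rw [map_sub]; module,
    inner_add_right, real_inner_smul_right]
  linarith

/-- The pairing with `P` undoes `P⁻¹`, and the skew terms in `L*` and `-L` cancel; only `½ Q` and
the inverse of `∂g` contribute. -/
theorem opN_monotone {g : U → EReal} (hg : Gamma0 g) (L : X →L[ℝ] U) {Q : X →L[ℝ] X}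
    (hQ : Q.IsPositive) (τ σ : ℝ) : MonotoneIn (precond L Q τ σ) (opN g L Q τ σ) := by
  intro z z' v hv v' hv'
  obtain ⟨h1, p, hp, h2⟩ := mem_opN.1 hv
  obtain ⟨h1', p', hp', h2'⟩ := mem_opN.1 hv'
  have hm := subdiff_monotone hg hp hp'
  have hq := hQ.inner_nonneg_right (z.fst - z'.fst)
  rw [map_sub, WithLp.prod_inner_apply]
  change 0 ≤ (inner ℝ (z.fst - z'.fst)
      ((precond L Q τ σ v).fst - (precond L Q τ σ v').fst) : ℝ)
    + inner ℝ (z.snd - z'.snd) ((precond L Q τ σ v).snd - (precond L Q τ σ v').snd)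
  rw [h1, h1', h2, h2',
    show (1 / 2 : ℝ) • Q z.fst + ContinuousLinearMap.adjoint L z.snd
        - ((1 / 2 : ℝ) • Q z'.fst + ContinuousLinearMap.adjoint L z'.snd)
      = (1 / 2 : ℝ) • Q (z.fst - z'.fst) + ContinuousLinearMap.adjoint L (z.snd - z'.snd) by
        rw [map_sub, map_sub]; module,
    show -(L z.fst) + p - (-(L z'.fst) + p') = (p - p') - L (z.fst - z'.fst) by
        rw [map_sub]; abel,
    inner_add_right, real_inner_smul_right, inner_sub_right,
    ContinuousLinearMap.adjoint_inner_right, real_inner_comm (z.snd - z'.snd) (L _),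
    real_inner_comm (p - p')]
  linarith

/-- The resolvent of `M` is given by a proximal step on `f`. -/
theorem sub_mem_opM {f : X → EReal} (hf : Gamma0 f) (L : X →L[ℝ] U) (Q : X →L[ℝ] X) (c : X)
    {τ : ℝ} (hτ : 0 < τ) (σ : ℝ) {s x : X} (u : U)
    (hx : x = prox (scale τ f) (s - (τ / 2) • Q s - τ • c)) :
    WithLp.toLp 2 (s, u) - WithLp.toLp 2 (x, u) ∈ opM f L Q c τ σ (WithLp.toLp 2 (x, u)) := by
  rw [← WithLp.toLp_sub, Prod.mk_sub_mk, sub_self]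
  have h := prox_mem hf hτ (s - (τ / 2) • Q s - τ • c)
  rw [← hx] at h
  refine mem_opM.2 ⟨⟨_, h, ?_⟩, by simp⟩
  -- The `-½ Q` of `P` removes `½ Q x`, so the inclusion is explicit: `(s - x)/τ - ½ Q s - c ∈
  -- ∂f(x)`.
  simp only [precond_fst, WithLp.toLp_fst, map_sub]
  match_scalars <;> field_simp <;> ring

/-- The resolvent of `N` is given by a proximal step on `g*`. -/
theorem sub_mem_opN {g : U → EReal} (hg : Gamma0 g) (L : X →L[ℝ] U) (Q : X →L[ℝ] X)
    {τ σ : ℝ} (hτ : 0 < τ) (hσ : 0 < σ) {s y : X} {u v : U}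
    (hv : v = prox (scale σ (conj g))
      (u + σ • L (s - (τ / 2) • Q s - τ • ContinuousLinearMap.adjoint L u)))
    (hy : y = s - (τ / 2) • Q s - τ • ContinuousLinearMap.adjoint L v) :
    WithLp.toLp 2 (s, u) - WithLp.toLp 2 (y, v) ∈ opN g L Q τ σ (WithLp.toLp 2 (y, v)) := by
  rw [← WithLp.toLp_sub, Prod.mk_sub_mk]
  have h := prox_conj_mem hg hσ
    (u + σ • L (s - (τ / 2) • Q s - τ • ContinuousLinearMap.adjoint L u))
  rw [← hv] at h
  refine mem_opN.2 ⟨?_, _, h, ?_⟩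
  · simp only [precond_fst, WithLp.toLp_fst, WithLp.toLp_snd, map_sub]
    rw [show s - y = (τ / 2) • Q s + τ • ContinuousLinearMap.adjoint L v by rw [hy]; abel]
    match_scalars <;> field_simp <;> ring
  -- Substituting `y` produces `τ L L* v`, which the block `-τ L L*` turns into the known `τ L L*
  -- u`.
  · simp only [precond_snd, WithLp.toLp_fst, WithLp.toLp_snd, hy, map_sub, map_smul]
    match_scalars <;> field_simp <;> ring

theorem exists_resolvent_opM {f : X → EReal} (hf : Gamma0 f) (L : X →L[ℝ] U) (Q : X →L[ℝ] X)
    (c : X) {τ : ℝ} (hτ : 0 < τ) (σ : ℝ) (r : WithLp 2 (X × U)) :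
    ∃ z, r - z ∈ opM f L Q c τ σ z :=
  ⟨_, sub_mem_opM hf L Q c hτ σ r.snd rfl⟩

theorem exists_resolvent_opN {g : U → EReal} (hg : Gamma0 g) (L : X →L[ℝ] U) (Q : X →L[ℝ] X)
    {τ σ : ℝ} (hτ : 0 < τ) (hσ : 0 < σ) (r : WithLp 2 (X × U)) :
    ∃ z, r - z ∈ opN g L Q τ σ z :=
  ⟨_, sub_mem_opN hg L Q hτ hσ (s := r.fst) (u := r.snd) rfl rfl⟩

/-- A solution of the primal inclusion yields a zero of `M + N`. -/
theorem exists_zero {f : X → EReal} {g : U → EReal} {L : X →L[ℝ] U} {Q : X →L[ℝ] X} {c : X}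
    {τ σ : ℝ} (hP : StronglyPositive (precond L Q τ σ))
    (hsol : ∃ x : X, (0 : X) ∈ subdiff f x
      + ContinuousLinearMap.adjoint L '' subdiff g (L x) + {Q x + c}) :
    ∃ z, ∃ a ∈ opM f L Q c τ σ z, -a ∈ opN g L Q τ σ z := by
  obtain ⟨x, _, ⟨ξ, hξ, _, ⟨v, hv, rfl⟩, rfl⟩, _, rfl, h0⟩ := hsol
  obtain ⟨a, ha⟩ := hP.surjective (WithLp.toLp 2 (ξ + ((1 / 2 : ℝ) • Q x + c), (0 : U)))
  refine ⟨WithLp.toLp 2 (x, v), a, mem_opM.2 ⟨⟨ξ, hξ, by rw [ha]; rfl⟩, by rw [ha]; rfl⟩,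
    mem_opN.2 ⟨?_, L x, hv, ?_⟩⟩
  · rw [map_neg, ha]
    change -(ξ + ((1 / 2 : ℝ) • Q x + c)) = (1 / 2 : ℝ) • Q x + ContinuousLinearMap.adjoint L v
    rw [neg_eq_iff_add_eq_zero, ← h0]
    module
  · rw [map_neg, ha]
    change -(0 : U) = -(L x) + L x
    simp

/-- The optimality system characterizes primal solutions. -/
theorem isPrimalSol_of_optimality {f : X → EReal} (hf : Gamma0 f) {g : U → EReal} (hg : Gamma0 g)
    {L : X →L[ℝ] U} {Q : X →L[ℝ] X} (hQ : Q.IsPositive) {c x ξ : X} {v : U}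
    (hξ : ξ ∈ subdiff f x) (hv : v ∈ subdiff g (L x))
    (h0 : ξ + (Q x + c) = -ContinuousLinearMap.adjoint L v) :
    IsPrimalSol f g L (quad Q c) x := by
  obtain ⟨s, hs⟩ := subdiff_real hf hξ
  obtain ⟨t, ht⟩ := subdiff_real hg hv
  intro y _
  have h1 := hξ y
  have h2 := hv (L y)
  have h3 := EReal.coe_le_coe_iff.2 (le_quad hQ c x y)
  rw [hs] at h1
  rw [ht] at h2
  refine le_trans (le_of_eq ?_) (add_le_add (add_le_add h1 h2) h3)
  simp only [quad, hs, ht, ← EReal.coe_add]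
  congr 1
  have h4 : (inner ℝ (y - x) ξ + inner ℝ (y - x) (Q x + c) : ℝ) = -inner ℝ (L y - L x) v := by
    rw [← inner_add_right, h0, inner_neg_right, ContinuousLinearMap.adjoint_inner_right, map_sub]
  linarith

/-- The optimality system characterizes dual solutions. -/
theorem isDualSol_of_optimality {f : X → EReal} (hf : Gamma0 f) {g : U → EReal} (hg : Gamma0 g)
    {L : X →L[ℝ] U} {Q : X →L[ℝ] X} (hQ : Q.IsPositive) {c x ξ : X} {v : U}
    (hξ : ξ ∈ subdiff f x) (hv : v ∈ subdiff g (L x))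
    (h0 : ξ + (Q x + c) = -ContinuousLinearMap.adjoint L v) :
    IsDualSol f g L (quad Q c) v := by
  obtain ⟨s, hs⟩ := subdiff_real hf hξ
  obtain ⟨t, ht⟩ := subdiff_real hg hv
  have hs' : f x + quad Q c x
      = ((s + (1 / 2 * inner ℝ x (Q x) + inner ℝ x c) : ℝ) : EReal) := by
    rw [hs, quad, ← EReal.coe_add]
  have hsum : -ContinuousLinearMap.adjoint L v ∈ subdiff (fun x => f x + quad Q c x) x := by
    intro y
    have h1 := hξ y
    rw [hs] at h1
    beta_reduce
    rw [hs', ← h0]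
    refine le_trans (le_of_eq ?_) (add_le_add h1 (EReal.coe_le_coe_iff.2 (le_quad hQ c x y)))
    simp only [← EReal.coe_add, inner_add_right]
    congr 1
    ring
  intro u _
  -- `x` and `L x` are subgradients of the two conjugates at `-L* v` and `v`; their linear terms
  -- cancel upon addition.
  have h1 := mem_subdiff_conj (f := fun x => f x + quad Q c x) hs' hsum (-ContinuousLinearMap.adjoint L u)
  have h2 := mem_subdiff_conj ht hv u
  refine le_trans (le_of_eq ?_) (add_le_add h1 h2)
  simp only [conj_eq (f := fun x => f x + quad Q c x) hs' hsum, conj_eq ht hv, ← EReal.coe_add]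
  congr 1
  have h4 : (inner ℝ (-ContinuousLinearMap.adjoint L u - -ContinuousLinearMap.adjoint L v) x : ℝ)
      = -inner ℝ (u - v) (L x) := by
    rw [← ContinuousLinearMap.adjoint_inner_left, ← inner_neg_left, map_sub]
    congr 1
    abel
  linarith

/-- Zeros of `M + N` are pairs of primal and dual solutions. -/
theorem isSol_of_zero {f : X → EReal} (hf : Gamma0 f) {g : U → EReal} (hg : Gamma0 g)
    {L : X →L[ℝ] U} {Q : X →L[ℝ] X} (hQ : Q.IsPositive) {c : X} {τ σ : ℝ}
    {z a : WithLp 2 (X × U)} (ha : a ∈ opM f L Q c τ σ z) (hb : -a ∈ opN g L Q τ σ z) :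
    IsPrimalSol f g L (quad Q c) z.fst ∧ IsDualSol f g L (quad Q c) z.snd := by
  obtain ⟨⟨ξ, hξ, h1⟩, h2⟩ := mem_opM.1 ha
  obtain ⟨h3, p, hp, h4⟩ := mem_opN.1 hb
  rw [map_neg] at h3 h4
  change -(precond L Q τ σ a).fst = _ at h3
  change -(precond L Q τ σ a).snd = _ at h4
  rw [h1] at h3
  rw [h2, neg_zero, eq_comm, neg_add_eq_zero] at h4
  subst h4
  have h0 : ξ + (Q z.fst + c) = -ContinuousLinearMap.adjoint L z.snd := by
    rw [eq_neg_iff_add_eq_zero]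
    rw [neg_eq_iff_add_eq_zero] at h3
    rw [← h3]
    module
  exact ⟨isPrimalSol_of_optimality hf hg hQ hξ hp h0, isDualSol_of_optimality hf hg hQ hξ hp h0⟩

/-! ### The two forms as Douglas–Rachford iterations -/

theorem IsFormI.isDouglasRachford {f : X → EReal} (hf : Gamma0 f) {g : U → EReal} (hg : Gamma0 g)
    {L : X →L[ℝ] U} {Q : X →L[ℝ] X} (hQ : Q.IsPositive) {c : X} {τ σ : ℝ} (hτ : 0 < τ)
    (hσ : 0 < σ) (hP : StronglyPositive (precond L Q τ σ)) {ρ : ℕ → ℝ} {s₀ : X} {u₀ : U}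
    {xh : ℕ → X} {uh : ℕ → U} {sh s : ℕ → X} {u : ℕ → U}
    (h : IsFormI f g L Q c τ σ ρ s₀ u₀ xh uh sh s u) :
    IsDouglasRachford (opM f L Q c τ σ) (opN g L Q τ σ) ρ
      (fun i => WithLp.toLp 2 (s i, u i)) (fun i => WithLp.toLp 2 (xh i, u i))
      (fun i => WithLp.toLp 2 (xh i + (sh i - s i), uh i)) where
  z_eq i := resolvent_eq_singleton hP (opM_monotone hf L hQ c τ σ)
    (sub_mem_opM hf L Q c hτ σ (u i) (h.xh_eq i))
  w_eq i := by
    have e : (2 : ℝ) • WithLp.toLp 2 (xh i, u i) - WithLp.toLp 2 (s i, u i)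
        = WithLp.toLp 2 ((2 : ℝ) • xh i - s i, u i) := by
      rw [← WithLp.toLp_smul, ← WithLp.toLp_sub, Prod.smul_mk, Prod.mk_sub_mk, two_smul ℝ (u i),
        add_sub_cancel_right]
    rw [e]
    refine resolvent_eq_singleton hP (opN_monotone hg L hQ τ σ)
      (sub_mem_opN hg L Q hτ hσ (h.uh_eq i) ?_)
    -- The first component of `w` is the point `y` of the resolvent of `N` evaluated at `(2 xh - s,
    -- u)`.
    rw [h.sh_eq i]
    module
  s_succ i := by
    rw [h.s_succ, h.u_succ, ← WithLp.toLp_sub, ← WithLp.toLp_smul, ← WithLp.toLp_add,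
      Prod.mk_sub_mk, Prod.smul_mk, Prod.mk_add_mk, add_sub_cancel_left]

theorem IsFormII.isDouglasRachford {f : X → EReal} (hf : Gamma0 f) {g : U → EReal}
    (hg : Gamma0 g) {L : X →L[ℝ] U} {Q : X →L[ℝ] X} (hQ : Q.IsPositive) {c : X} {τ σ : ℝ}
    (hτ : 0 < τ) (hσ : 0 < σ) (hP : StronglyPositive (precond L Q τ σ)) {ρ : ℕ → ℝ} {s₀ : X}
    {u₀ : U} {uh : ℕ → U} {yh xh s : ℕ → X} {u : ℕ → U}
    (h : IsFormII f g L Q c τ σ ρ s₀ u₀ uh yh xh s u) :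
    IsDouglasRachford (opN g L Q τ σ) (opM f L Q c τ σ) ρ
      (fun i => WithLp.toLp 2 (s i, u i)) (fun i => WithLp.toLp 2 (yh i, uh i))
      (fun i => WithLp.toLp 2 (xh i, (2 : ℝ) • uh i - u i)) where
  z_eq i := resolvent_eq_singleton hP (opN_monotone hg L hQ τ σ)
    (sub_mem_opN hg L Q hτ hσ (h.uh_eq i) (h.yh_eq i))
  w_eq i := by
    rw [← WithLp.toLp_smul, ← WithLp.toLp_sub, Prod.smul_mk, Prod.mk_sub_mk]
    exact resolvent_eq_singleton hP (opM_monotone hf L hQ c τ σ)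
      (sub_mem_opM hf L Q c hτ σ _ (h.xh_eq i))
  s_succ i := by
    rw [h.s_succ, h.u_succ, ← WithLp.toLp_sub, ← WithLp.toLp_smul, ← WithLp.toLp_add,
      Prod.mk_sub_mk, Prod.smul_mk, Prod.mk_add_mk, two_smul,
      show uh i + uh i - u i - uh i = uh i - u i by abel]

end PrimalDual

end PDDR

theorem theorem7p4 {X U : Type*}
    [NormedAddCommGroup X] [InnerProductSpace ℝ X] [CompleteSpace X]
    [NormedAddCommGroup U] [InnerProductSpace ℝ U] [CompleteSpace U]
    (f : X → EReal) (hf : PDDR.Gamma0 f) (g : U → EReal) (hg : PDDR.Gamma0 g)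
    (L : X →L[ℝ] U) (Q : X →L[ℝ] X) (hQ : Q.IsPositive) (hQ0 : Q ≠ 0) (c : X)
    -- the primal monotone inclusion has a solution
    (hsol : ∃ x : X, (0 : X) ∈ PDDR.subdiff f x
      + ContinuousLinearMap.adjoint L '' PDDR.subdiff g (L x) + {Q x + c})
    (τ σ : ℝ) (hτ : 0 < τ) (hτQ : τ < 2 / ‖Q‖) (hσ : 0 < σ) (hστ : σ * τ * ‖L‖ ^ 2 < 1)
    (ρ : ℕ → ℝ) (hρ : ∀ i, ρ i ∈ Set.Icc (0 : ℝ) 2)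
    (hρsum : Tendsto (fun n => ∑ i ∈ Finset.range n, ρ i * (2 - ρ i)) atTop atTop)
    (s₀ : X) (u₀ : U) :
    -- form I: convergence
    (∀ (xh : ℕ → X) (uh : ℕ → U) (sh s : ℕ → X) (u : ℕ → U),
      PDDR.IsFormI f g L Q c τ σ ρ s₀ u₀ xh uh sh s u →
        ∃ (x' : X) (u' : U),
          PDDR.IsPrimalSol f g L (PDDR.quad Q c) x' ∧ PDDR.IsDualSol f g L (PDDR.quad Q c) u' ∧
          PDDR.WeakTendsto xh x' ∧ PDDR.WeakTendsto u u') ∧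
    -- form II: convergence
    (∀ (uh : ℕ → U) (yh xh s : ℕ → X) (u : ℕ → U),
      PDDR.IsFormII f g L Q c τ σ ρ s₀ u₀ uh yh xh s u →
        ∃ (x' : X) (u' : U),
          PDDR.IsPrimalSol f g L (PDDR.quad Q c) x' ∧ PDDR.IsDualSol f g L (PDDR.quad Q c) u' ∧
          PDDR.WeakTendsto xh x' ∧ PDDR.WeakTendsto u u') ∧
    -- `P` defines the Hilbert space `Z_P`, in which `M` and `N` are maximally monotone
    IsSelfAdjoint (PDDR.precond L Q τ σ) ∧ PDDR.StronglyPositive (PDDR.precond L Q τ σ) ∧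
    PDDR.MaxMonotoneIn (PDDR.precond L Q τ σ) (PDDR.opM f L Q c τ σ) ∧
    PDDR.MaxMonotoneIn (PDDR.precond L Q τ σ) (PDDR.opN g L Q τ σ) ∧
    -- form I is the Douglas–Rachford iteration for `M`, `N`
    (∀ (xh : ℕ → X) (uh : ℕ → U) (sh s : ℕ → X) (u : ℕ → U),
      PDDR.IsFormI f g L Q c τ σ ρ s₀ u₀ xh uh sh s u →
        PDDR.IsDouglasRachford (PDDR.opM f L Q c τ σ) (PDDR.opN g L Q τ σ) ρ
          (fun i => WithLp.toLp 2 (s i, u i)) (fun i => WithLp.toLp 2 (xh i, u i))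
          (fun i => WithLp.toLp 2 (xh i + (sh i - s i), uh i))) ∧
    -- form II is the Douglas–Rachford iteration for `N`, `M`
    (∀ (uh : ℕ → U) (yh xh s : ℕ → X) (u : ℕ → U),
      PDDR.IsFormII f g L Q c τ σ ρ s₀ u₀ uh yh xh s u →
        PDDR.IsDouglasRachford (PDDR.opN g L Q τ σ) (PDDR.opM f L Q c τ σ) ρ
          (fun i => WithLp.toLp 2 (s i, u i)) (fun i => WithLp.toLp 2 (yh i, uh i))
          (fun i => WithLp.toLp 2 (xh i, (2 : ℝ) • uh i - u i))) := by 
  have hβ : 0 < ‖Q‖ := norm_pos_iff.2 hQ0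
  have hτQ' : τ * ‖Q‖ < 2 := by rwa [lt_div_iff₀ hβ] at hτQ
  have hsa := PDDR.precond_isSelfAdjoint (L := L) hQ τ σ
  have hP := PDDR.precond_stronglyPositive (L := L) hQ hτ hσ hτQ' hστ
  have hM := PDDR.opM_monotone hf L hQ c τ σ
  have hN := PDDR.opN_monotone hg L hQ τ σ
  have hMs := PDDR.exists_resolvent_opM hf L Q c hτ σ
  have hNs := PDDR.exists_resolvent_opN hg L Q hτ hσ
  have hzero := PDDR.exists_zero (hP := hP) hsol
  refine ⟨fun xh uh sh s u h => ?_, fun uh yh xh s u h => ?_, hsa, hP,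
    PDDR.maxMonotoneIn_of_surjective hP hM hMs, PDDR.maxMonotoneIn_of_surjective hP hN hNs,
    fun xh uh sh s u h => h.isDouglasRachford hf hg hQ hτ hσ hP,
    fun uh yh xh s u h => h.isDouglasRachford hf hg hQ hτ hσ hP⟩
  · obtain ⟨z, ⟨a, ha, hb⟩, hz, -⟩ := (h.isDouglasRachford hf hg hQ hτ hσ hP).weak_convergence
      hsa hP hM hN hMs hNs hzero hρ hρsum
    obtain ⟨hp, hd⟩ := PDDR.isSol_of_zero hf hg hQ ha hb
    exact ⟨z.fst, z.snd, hp, hd, PDDR.weakTendsto_fst hz, PDDR.weakTendsto_snd hz⟩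
  · obtain ⟨z, ⟨a, ha, hb⟩, hz, hd⟩ := (h.isDouglasRachford hf hg hQ hτ hσ hP).weak_convergence
      hsa hP hN hM hNs hMs (by
        obtain ⟨z, a, ha, hb⟩ := hzero
        exact ⟨z, -a, hb, by rwa [neg_neg]⟩) hρ hρsum
    obtain ⟨hp, hd'⟩ := PDDR.isSol_of_zero hf hg hQ hb (by rwa [neg_neg])
    refine ⟨z.fst, z.snd, hp, hd', ?_, ?_⟩
    -- Here `z = (yh, uh)`, while the claim concerns `xh` and `u`. The former is a component of `w =
    -- z + (w - z)`.
    · refine PDDR.weakTendsto_fst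
        (z := fun i => WithLp.toLp 2 (xh i, (2 : ℝ) • uh i - u i)) fun y => ?_
      have := (hz y).add (hd.inner (𝕜 := ℝ) (tendsto_const_nhds (x := y)))
      simpa only [← inner_add_left, add_sub_cancel, inner_zero_left, add_zero] using this
    -- The second component of `z - (w - z)` is `uh - (uh - u) = u`.
    · refine PDDR.weakTendsto_snd (z := fun i => WithLp.toLp 2 ((2 : ℝ) • yh i - xh i, u i))
        fun y => ?_
      have := (hz y).sub (hd.inner (𝕜 := ℝ) (tendsto_const_nhds (x := y)))
      rw [inner_zero_left, sub_zero] at this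
      refine this.congr fun i => ?_
      rw [← inner_sub_left]
      congr 1
      refine WithLp.ofLp_injective 2 (Prod.ext ?_ ?_)
      · change yh i - (xh i - yh i) = (2 : ℝ) • yh i - xh i
        module
      · change uh i - ((2 : ℝ) • uh i - u i - uh i) = u i
        module
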